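/- Let $\mathsf Z(t)=\pi^{-it/2}\frac{\Gamma(1/4+it/2)}{|\Gamma(1/4+it/2)|}\zeta(\tfrac12+it)$ ($t\in\mathbb R$) be Hardy's function, which is real-valued, and let $\mathsf Z^{(n)}$ be its $n$-th derivative. For an integer $n\ge 0$ let $0\le t_0\le t_1\le\cdots$ be the non-negative zeros of $\mathsf Z^{(n)}$, repeated according to multiplicity, and put $$\Theta^{(n)}=\limsup_{k\to\infty}\frac{t_{k+1}-t_k}{2\pi/\log t_k}\in[0,\infty].$$ Let $l\ge 1$ and $n\ge 0$ be integers. Assume that for every integer $h$ with $0\le h\le l$ there is a constant $d_{h,l}=d_{h,l}(n+1,n)$ such that $$\frac1T\int_0^T|\mathsf Z^{(n+1)}(t)|^{2h}\,|\mathsf Z^{(n)}(t)|^{2l-2h}\,dt\sim d_{h,l}\,(\log T)^{l^2+2ln+2h},\qquad T\to\infty,$$ with $d_{l,l}\ne 0$, and put $B(h,l;n)=4^{h-l}\,d_{h,l}/d_{l,l}$ for $0\le h\le l$. Let $v_1,\dots,v_l$ be real numbers with $v_l=1$ such that $$G(u)=(2l-1)\sum_{h=1}^{l}\binom lh v_h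 u^{2h}$$ is strictly increasing on $[0,\infty)$. Then the equation $$\int_0^\infty\log\Bigl(1+\frac{G(u)}{(2l-1)\lambda}\Bigr)\frac{du}{u^2}=l\pi$$ has a unique root $\lambda>0$; with this $\lambda$ the equation $$\sum_{h=1}^{l}\frac{2l-1}{2h-1}\binom lh B(h,l;n)\,v_h\,\mathcal X^{h}=(2l-1)\,\lambda\,B(0,l;n)$$ has a unique positive real root $\mathcal X$; and $$\mathcal X\le(\Theta^{(n)})^2 .$$ This holds for every admissible choice of $v_1,\dots,v_{l-1}$, in particular for one that maximises $\mathcal X$. -/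

import Mathlib

open scoped ComplexConjugate

namespace HallGap

/-- The defining expression `π^{-it/2} Γ(1/4 + it/2) / |Γ(1/4 + it/2)| ζ(1/2 + it)` of Hardy's
function, as a complex number. -/
noncomputable def hardyZExpr (t : ℝ) : ℂ :=
  (Real.pi : ℂ) ^ (-(Complex.I * t / 2))
    * (Complex.Gamma (1 / 4 + Complex.I * t / 2) / ‖Complex.Gamma (1 / 4 + Complex.I * t / 2)‖)
    * riemannZeta (1 / 2 + Complex.I * t)

/-- Hardy's function `Z : ℝ → ℝ`. Its defining expression is a real number, see `ofReal_hardyZ`. -/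
noncomputable def hardyZ (t : ℝ) : ℝ := (hardyZExpr t).re

/-- The defining expression of Hardy's function is real, so nothing is lost in `hardyZ`. -/
theorem ofReal_hardyZ (t : ℝ) : ((hardyZ t : ℝ) : ℂ) = hardyZExpr t := by
  have hpi : (Real.pi : ℂ) ≠ 0 := by exact_mod_cast Real.pi_ne_zero
  set s : ℂ := 1 / 2 + Complex.I * t with hs
  have hs0 : s ≠ 0 := by
    intro h
    have := congrArg Complex.re h
    norm_num [hs] at this
  have hre : 0 < s.re := by norm_num [hs]
  have hG : Complex.Gammaℝ s ≠ 0 := Complex.Gammaℝ_ne_zero_of_re_pos hre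
  have hcs : conj s = 1 - s := by
    apply Complex.ext <;> norm_num [hs]
  have hLam : completedRiemannZeta s = Complex.Gammaℝ s * riemannZeta s := by
    rw [riemannZeta_def_of_ne_zero hs0]
    field_simp
  have hGc : Complex.Gammaℝ (conj s) = conj (Complex.Gammaℝ s) := by
    have harg : (Real.pi : ℂ).arg ≠ Real.pi := by
      rw [Complex.arg_ofReal_of_nonneg Real.pi_pos.le]
      exact Real.pi_pos.ne
    have h1 : -conj s / 2 = conj (-s / 2) := by rw [map_div₀, map_neg, Complex.conj_ofNat]
    have h2 : conj s / 2 = conj (s / 2) := by rw [map_div₀, Complex.conj_ofNat]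
    rw [Complex.Gammaℝ_def, Complex.Gammaℝ_def, map_mul, h1, h2, Complex.Gamma_conj,
      Complex.cpow_conj _ _ harg, Complex.conj_ofReal]
  have hs0' : conj s ≠ 0 := by simpa using hs0
  have hG' : Complex.Gammaℝ (conj s) ≠ 0 := by
    rw [hGc]; simpa using hG
  have hLamc : conj (completedRiemannZeta s) = completedRiemannZeta s := by
    have h1 : completedRiemannZeta (conj s) = Complex.Gammaℝ (conj s) * riemannZeta (conj s) := by
      rw [riemannZeta_def_of_ne_zero hs0']
      field_simp
    rw [hLam, map_mul, ← hGc, ← riemannZeta_conj, ← h1, hcs, completedRiemannZeta_one_sub, hLam]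
  have hpow : (Real.pi : ℂ) ^ (-(Complex.I * t / 2))
      = ((Real.pi ^ (1 / 4 : ℝ) : ℝ) : ℂ) * (Real.pi : ℂ) ^ (-s / 2) := by
    rw [Complex.ofReal_cpow Real.pi_pos.le, ← Complex.cpow_add _ _ hpi]
    congr 1
    rw [hs]; push_cast; ring
  have harg4 : (1 / 4 + Complex.I * t / 2 : ℂ) = s / 2 := by rw [hs]; ring
  have key : hardyZExpr t
      = ((Real.pi ^ (1 / 4 : ℝ) / ‖Complex.Gamma (s / 2)‖ : ℝ) : ℂ) * completedRiemannZeta s := by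
    rw [hardyZExpr, harg4, hpow, ← hs, hLam, Complex.Gammaℝ_def]
    push_cast
    ring
  rw [hardyZ]
  apply Complex.conj_eq_iff_re.mp
  rw [key, map_mul, hLamc, Complex.conj_ofReal]

/-- The `n`-th derivative `Z^{(n)}` of Hardy's function. -/
noncomputable def hardyZDeriv (n : ℕ) : ℝ → ℝ := iteratedDeriv n hardyZ

/-- The number of zeros of `f` in `[0, x]`, a zero of order `r` being counted `r` times
(the pairs `(z, 0), …, (z, r - 1)`). -/
noncomputable def zeroCount (f : ℝ → ℝ) (x : ℝ) : ℕ∞ :=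
  {p : ℝ × ℕ | 0 ≤ p.1 ∧ p.1 ≤ x ∧ (p.2 : ℕ∞) < analyticOrderAt f p.1}.encard

/-- The non-negative zeros `t₀ ≤ t₁ ≤ t₂ ≤ …` of `f`, in increasing order and repeated according
to multiplicity: `t_k` is the least `x` such that `[0, x]` contains at least `k + 1` zeros. -/
noncomputable def zeroSeq (f : ℝ → ℝ) (k : ℕ) : ℝ :=
  sInf {x : ℝ | (k : ℕ∞) < zeroCount f x}

open Classical in
/-- `Θ^{(n)} = limsup_k (t_{k+1} - t_k) / (2π / log t_k)`, where `t_k` runs through the non-negative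
zeros of `Z^{(n)}`, as an extended real number. The limsup presupposes that `Z^{(n)}` has infinitely
many non-negative zeros; the value `⊤` in the other case (the last gap would be infinite) only
makes the definition total. -/
noncomputable def theta (n : ℕ) : EReal :=
  if {t : ℝ | 0 ≤ t ∧ hardyZDeriv n t = 0}.Infinite then
    Filter.limsup (fun k : ℕ =>
      (((zeroSeq (hardyZDeriv n) (k + 1) - zeroSeq (hardyZDeriv n) k)
        / (2 * Real.pi / Real.log (zeroSeq (hardyZDeriv n) k)) : ℝ) : EReal)) Filter.atTop
  else ⊤

/-- `(1/T) ∫₀ᵀ |Z^{(n+1)}(t)|^{2h} |Z^{(n)}(t)|^{2l-2h} dt`, for `h ≤ l`. -/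
noncomputable def jointMoment (l h n : ℕ) (T : ℝ) : ℝ :=
  (1 / T) * ∫ t in (0 : ℝ)..T,
    |hardyZDeriv (n + 1) t| ^ (2 * h) * |hardyZDeriv n t| ^ (2 * l - 2 * h)

/-- The constant `d` is the leading coefficient in
`(1/T) ∫₀ᵀ |Z^{(n+1)}|^{2h} |Z^{(n)}|^{2l-2h} dt ∼ d (log T)^{l² + 2ln + 2h}`, `T → ∞`. -/
def IsLeadingCoeff (l h n : ℕ) (d : ℝ) : Prop :=
  Asymptotics.IsEquivalent Filter.atTop (jointMoment l h n)
    (fun T : ℝ => d * Real.log T ^ (l ^ 2 + 2 * l * n + 2 * h))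

/-- `B(h,l;n) = 4^{h-l} d_{h,l} / d_{l,l}`, where `d h` stands for `d_{h,l}(n+1,n)`. -/
noncomputable def ratioB (l : ℕ) (d : ℕ → ℝ) (h : ℕ) : ℝ :=
  (4 : ℝ) ^ ((h : ℤ) - (l : ℤ)) * (d h / d l)

/-- `G(u) = (2l-1) ∑_{h=1}^l binom(l,h) v_h u^{2h}`. -/
noncomputable def G (l : ℕ) (v : ℕ → ℝ) (u : ℝ) : ℝ :=
  (2 * (l : ℝ) - 1) * ∑ h ∈ Finset.Icc 1 l, (l.choose h : ℝ) * v h * u ^ (2 * h)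

/-- `lam` is a root of `∫₀^∞ log (1 + G(u) / ((2l-1) lam)) du / u² = l π`; the logarithm asks for
`lam > 0`. (The right-hand side is nonzero for `l ≥ 1`, so the equation includes that the integrand
is integrable.) -/
def IsLambda (l : ℕ) (v : ℕ → ℝ) (lam : ℝ) : Prop :=
  0 < lam ∧
    ∫ u in Set.Ioi (0 : ℝ), Real.log (1 + G l v u / ((2 * (l : ℝ) - 1) * lam)) / u ^ 2
      = l * Real.pi

/-- `X` is a positive real root of
`∑_{h=1}^l (2l-1)/(2h-1) binom(l,h) B(h,l;n) v_h X^h = (2l-1) lam B(0,l;n)`. -/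
def IsPosRoot (l : ℕ) (d v : ℕ → ℝ) (lam X : ℝ) : Prop :=
  0 < X ∧
    ∑ h ∈ Finset.Icc 1 l,
        (2 * (l : ℝ) - 1) / (2 * (h : ℝ) - 1) * (l.choose h : ℝ) * ratioB l d h * v h * X ^ h
      = (2 * (l : ℝ) - 1) * lam * ratioB l d 0

end HallGap

/-!
Let `L` be the even polynomial whose Hamiltonian `H(u) = u L'(u) - L(u)` is `G`; monotonicity of `G`
on `[0, ∞)` means that `L` is strictly convex. Write `H(p)` for the energy at momentum `p = L'(u)`.
If `p` solves the Hamilton–Jacobi equation `p' = H(p) + K` on an interval, then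
`p u - p' ≤ L(u) - K`, and this calibration proves the Wirtinger-type inequality
`K ∫ f^{2l} ≤ ∫ f^{2l} L(κ f' / f)` between two zeros of `f` whose distance, scaled by `l / κ`, is
less than half the time in which `p` runs from `-∞` to `∞`. An integration by parts turns this half
into `∫₀^∞ log (1 + H(u) / K) du / u²`, so that the equation for `λ` says that `K = (2l-1)λ` is the
energy level at which it equals `lπ`.

If `B > Θ^{(n)}`, all late gaps of `f = Z^{(n)}` are below `2πB / log t`, and adding up the
inequalities with `κ = 2B / log T` up to a zero `T` shows, after division by `T (log T)^{l²+2ln}`,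
that `K d₀ ≤ Q((2B)²)`, where `Q(x)` is a polynomial with coefficients proportional to the moment
constants `d_h`. The equation for `𝒳` reads `Q(4𝒳) = K d₀`, and `Q` is strictly increasing on
`[0, ∞)` because the energies `∫ f^{2l} L(s f' / f)` are increasing in `s`; hence `𝒳 ≤ B²`.
-/

namespace HallGap

open Filter Topology Set MeasureTheory Asymptotics Polynomial

section Polynomial

variable {P : ℝ[X]}

theorem strictMonoOn_eval_of_monotoneOn {s : Set ℝ} [s.OrdConnected] (hP : 0 < P.degree)
    (h : MonotoneOn (fun x ↦ P.eval x) s) : StrictMonoOn (fun x ↦ P.eval x) s := by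
  intro a ha b hb hab
  refine (h ha hb hab.le).lt_of_ne fun (heq : P.eval a = P.eval b) ↦ ?_
  have hconst : Icc a b ⊆ {x | P.eval x = (C (P.eval a)).eval x} := fun x hx ↦ by
    have hxs : x ∈ s := Set.OrdConnected.out ‹_› ha hb hx
    simpa only [mem_ofPred_eq, eval_C] using
      le_antisymm ((h hxs hb hx.2).trans heq.ge) (h ha hxs hx.1)
  have : P = C (P.eval a) := eq_of_infinite_eval_eq _ _ ((Icc_infinite hab).mono hconst)
  exact hP.not_ge (this ▸ degree_C_le)

theorem tendsto_eval_atTop_of_monotoneOn {a : ℝ} (hP : 0 < P.degree)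
    (h : MonotoneOn (fun x ↦ P.eval x) (Ici a)) :
    Tendsto (fun x ↦ P.eval x) atTop atTop := by
  rcases le_total 0 P.leadingCoeff with hlead | hlead
  · exact P.tendsto_atTop_of_leadingCoeff_nonneg hP hlead
  · obtain ⟨x, hx, hax⟩ := (((P.tendsto_atBot_of_leadingCoeff_nonpos hP hlead).eventually_lt_atBot
      (P.eval a)).and (eventually_ge_atTop a)).exists
    exact absurd (h self_mem_Ici hax hax) hx.not_ge

theorem existsUnique_pos_eval_eq (hP : 0 < P.degree) (h : MonotoneOn (fun x ↦ P.eval x) (Ici 0))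
    {r : ℝ} (hr : P.eval 0 < r) : ∃! x, 0 < x ∧ P.eval x = r := by
  obtain ⟨b, hrb, hb⟩ := (((tendsto_eval_atTop_of_monotoneOn hP h).eventually_ge_atTop r).and
    (eventually_ge_atTop 0)).exists
  obtain ⟨x, hx, hxr⟩ := intermediate_value_Ioc hb P.continuousOn ⟨hr, hrb⟩
  exact ⟨x, ⟨hx.1, hxr⟩, fun y hy ↦ (strictMonoOn_eval_of_monotoneOn hP h).injOn hy.1.le hx.1.le
    (hy.2.trans hxr.symm)⟩

end Polynomial

section Lagrangian

/-- The Hamiltonian `u L'(u) - L(u)` of a Lagrangian `L`, as a function of the velocity `u`. -/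
noncomputable def hamiltonian (L : ℝ[X]) : ℝ[X] := X * derivative L - L

/-- An even polynomial Lagrangian without constant term whose Hamiltonian is strictly increasing in
the speed. It is the one-dimensional integrand, at `y = 1`, of the Wirtinger-type inequality below;
its momentum is `derivative L`. -/
structure IsLagrangian (L : ℝ[X]) : Prop where
  zero : L.eval 0 = 0
  even (u : ℝ) : L.eval (-u) = L.eval u
  strictMonoOn_hamiltonian : StrictMonoOn (fun u ↦ (hamiltonian L).eval u) (Ici 0)

theorem eval_hamiltonian (L : ℝ[X]) (u : ℝ) :
    (hamiltonian L).eval u = u * (derivative L).eval u - L.eval u := by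
  simp only [hamiltonian, eval_sub, eval_mul, eval_X]

theorem derivative_hamiltonian (L : ℝ[X]) :
    derivative (hamiltonian L) = X * derivative (derivative L) := by
  simp only [hamiltonian, derivative_sub, derivative_mul, derivative_X]
  ring

namespace IsLagrangian

variable {L : ℝ[X]} (hL : IsLagrangian L)
include hL

theorem X_sq_dvd_hamiltonian : X ^ 2 ∣ hamiltonian L := by
  have h0 : L.coeff 0 = 0 := by rw [coeff_zero_eq_eval_zero, hL.zero]
  refine X_pow_dvd_iff.2 fun i hi ↦ ?_
  interval_cases i
  · simp [hamiltonian, h0]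
  · simp [hamiltonian, coeff_derivative]

theorem eval_derivative_neg (u : ℝ) :
    (derivative L).eval (-u) = -(derivative L).eval u := by
  have heven : L.comp (-X) = L := Polynomial.funext fun r ↦ by simpa using hL.even r
  have hodd := congrArg (fun P ↦ (derivative P).eval u) heven
  simp only [derivative_comp, derivative_neg, derivative_X, eval_mul, eval_neg, eval_one,
    eval_comp, eval_X] at hodd
  linarith

theorem eval_derivative_zero : (derivative L).eval 0 = 0 :=
  self_eq_neg.1 (by simpa only [neg_zero] using hL.eval_derivative_neg 0)

theorem eval_hamiltonian_neg (u : ℝ) : (hamiltonian L).eval (-u) = (hamiltonian L).eval u := by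
  rw [eval_hamiltonian, eval_hamiltonian, hL.eval_derivative_neg, hL.even]
  ring

theorem eval_hamiltonian_abs (u : ℝ) : (hamiltonian L).eval |u| = (hamiltonian L).eval u := by
  rcases abs_choice u with h | h <;> simp only [h, hL.eval_hamiltonian_neg]

theorem eval_hamiltonian_nonneg (u : ℝ) : 0 ≤ (hamiltonian L).eval u := by
  have h0 : (hamiltonian L).eval 0 = 0 := by simp [eval_hamiltonian, hL.zero]
  rw [← hL.eval_hamiltonian_abs, ← h0]
  exact hL.strictMonoOn_hamiltonian.monotoneOn self_mem_Ici (abs_nonneg u) (abs_nonneg u)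

theorem degree_derivative_pos : 0 < (derivative L).degree := by
  by_contra! hdeg
  have hconst : hamiltonian L = C ((hamiltonian L).coeff 0) := by
    refine eq_C_of_derivative_eq_zero ?_
    rw [derivative_hamiltonian, eq_C_of_degree_le_zero hdeg, derivative_C, mul_zero]
  have hlt := hL.strictMonoOn_hamiltonian self_mem_Ici (mem_Ici.2 zero_le_one) zero_lt_one
  rw [hconst] at hlt
  simp only [eval_C, lt_self_iff_false] at hlt

theorem strictMono_eval_derivative : StrictMono fun u ↦ (derivative L).eval u := by
  refine strictMono_of_odd_strictMonoOn_nonneg hL.eval_derivative_neg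
    (strictMonoOn_eval_of_monotoneOn hL.degree_derivative_pos ?_)
  refine monotoneOn_of_deriv_nonneg (convex_Ici 0) (derivative L).continuousOn
    (derivative L).differentiable.differentiableOn fun u hu ↦ ?_
  rw [interior_Ici, mem_Ioi] at hu
  have hderiv : 0 ≤ derivWithin (fun u ↦ (hamiltonian L).eval u) (Ici 0) u :=
    hL.strictMonoOn_hamiltonian.monotoneOn.derivWithin_nonneg
  rw [(hamiltonian L).derivWithin (uniqueDiffOn_Ici 0 u hu.le), derivative_hamiltonian,
    eval_mul, eval_X] at hderiv
  rw [Polynomial.deriv]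
  exact nonneg_of_mul_nonneg_right hderiv hu

theorem surjective_eval_derivative : Function.Surjective fun u ↦ (derivative L).eval u := by
  have htop := tendsto_eval_atTop_of_monotoneOn (a := 0) hL.degree_derivative_pos
    (hL.strictMono_eval_derivative.monotone.monotoneOn _)
  refine (derivative L).continuous.surjective htop ?_
  refine (tendsto_neg_atTop_atBot.comp (htop.comp tendsto_neg_atBot_atTop)).congr fun u ↦ ?_
  simp only [Function.comp_apply, hL.eval_derivative_neg, neg_neg]

theorem convexOn : ConvexOn ℝ univ fun u ↦ L.eval u := by
  refine Monotone.convexOn_univ_of_deriv L.differentiable ?_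
  have hderiv : deriv (fun u ↦ L.eval u) = fun u ↦ (derivative L).eval u :=
    funext fun _ ↦ L.deriv
  rw [hderiv]
  exact hL.strictMono_eval_derivative.monotone

theorem tangent_le_eval (m u : ℝ) : L.eval m + (derivative L).eval m * (u - m) ≤ L.eval u := by
  rcases lt_trichotomy m u with h | rfl | h
  · have := hL.convexOn.le_slope_of_hasDerivAt (mem_univ m) (mem_univ u) h (L.hasDerivAt m)
    rw [slope_def_field, le_div_iff₀ (sub_pos.2 h)] at this
    linarith
  · simp only [sub_self, mul_zero, add_zero, le_refl]
  · have := hL.convexOn.slope_le_of_hasDerivAt (mem_univ u) (mem_univ m) h (L.hasDerivAt m)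
    rw [slope_def_field, div_le_iff₀ (sub_pos.2 h)] at this
    linarith

theorem eval_le_eval_of_abs_le {u w : ℝ} (h : |u| ≤ |w|) : L.eval u ≤ L.eval w := by
  have hmono : MonotoneOn (fun u ↦ L.eval u) (Ici 0) := by
    refine monotoneOn_of_deriv_nonneg (convex_Ici 0) L.continuousOn
      L.differentiable.differentiableOn fun u hu ↦ ?_
    rw [interior_Ici, mem_Ioi] at hu
    rw [Polynomial.deriv, ← hL.eval_derivative_zero]
    exact (hL.strictMono_eval_derivative hu).le
  have habs (x : ℝ) : L.eval |x| = L.eval x := by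
    rcases abs_choice x with h | h <;> simp only [h, hL.even]
  rw [← habs u, ← habs w]
  exact hmono (abs_nonneg u) (abs_nonneg w) h

/-- The Legendre transformation `u ↦ L'(u)` from velocities to momenta. -/
noncomputable def momentumIso : ℝ ≃o ℝ :=
  hL.strictMono_eval_derivative.orderIsoOfSurjective _ hL.surjective_eval_derivative

theorem momentumIso_apply (u : ℝ) : hL.momentumIso u = (derivative L).eval u := rfl

theorem momentumIso_symm_neg (p : ℝ) : hL.momentumIso.symm (-p) = -hL.momentumIso.symm p := by
  rw [OrderIso.symm_apply_eq, hL.momentumIso_apply, hL.eval_derivative_neg, ← hL.momentumIso_apply,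
    OrderIso.apply_symm_apply]

theorem fenchel_inequality (p u : ℝ) :
    p * u - (hamiltonian L).eval (hL.momentumIso.symm p) ≤ L.eval u := by
  have htangent := hL.tangent_le_eval (hL.momentumIso.symm p) u
  rw [← hL.momentumIso_apply, OrderIso.apply_symm_apply] at htangent
  rw [eval_hamiltonian, ← hL.momentumIso_apply, OrderIso.apply_symm_apply]
  linarith

end IsLagrangian

end Lagrangian

section LogKernel

variable {H : ℝ[X]} {K u : ℝ}

/-- The integrand `log (1 + H(u) / K) / u²` of the equation which fixes the energy level `K` of the
Hamiltonian `H` (and hence `λ`). -/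
noncomputable def logKernel (H : ℝ[X]) (K u : ℝ) : ℝ := Real.log (1 + H.eval u / K) / u ^ 2

theorem logKernel_nonneg (hH : 0 ≤ H.eval u) (hK : 0 < K) : 0 ≤ logKernel H K u :=
  div_nonneg (Real.log_nonneg (le_add_of_nonneg_right (div_nonneg hH hK.le))) (sq_nonneg u)

theorem logKernel_anti {K' : ℝ} (hH : 0 ≤ H.eval u) (hK : 0 < K) (hKK' : K ≤ K') :
    logKernel H K' u ≤ logKernel H K u := by
  have : 0 < 1 + H.eval u / K' := by have := hK.trans_le hKK'; positivity
  unfold logKernel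
  gcongr

theorem logKernel_strictAnti {K' : ℝ} (hH : 0 < H.eval u) (hu : 0 < u) (hK : 0 < K)
    (hKK' : K < K') : logKernel H K' u < logKernel H K u := by
  have : 0 < 1 + H.eval u / K' := by have := hK.trans hKK'; positivity
  unfold logKernel
  gcongr

theorem continuousAt_logKernel_left (hH : 0 ≤ H.eval u) (hK : 0 < K) :
    ContinuousAt (fun K ↦ logKernel H K u) K := by
  have : 1 + H.eval u / K ≠ 0 := by positivity
  exact ((continuousAt_const.add (continuousAt_const.div continuousAt_id hK.ne')).log
    this).div_const _

theorem tendsto_logKernel_atTop (H : ℝ[X]) (u : ℝ) :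
    Tendsto (fun K ↦ logKernel H K u) atTop (𝓝 0) := by
  have harg : Tendsto (fun K ↦ 1 + H.eval u / K) atTop (𝓝 (1 + 0)) :=
    (tendsto_const_nhds.div_atTop tendsto_id).const_add 1
  simpa only [logKernel, add_zero, Real.log_one, zero_div] using
    (harg.log (by norm_num)).div_const (u ^ 2)

variable (hpos : ∀ u, 0 < u → 0 < H.eval u)
include hpos

theorem continuousOn_logKernel (hK : 0 < K) : ContinuousOn (logKernel H K) (Ioi 0) := by
  intro u hu
  have harg : 1 + H.eval u / K ≠ 0 := by have := hpos u hu; positivity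
  exact (((continuousAt_const.add (H.continuous.continuousAt.div_const K)).log harg).div
    (continuousAt_id.pow 2) (pow_ne_zero 2 (ne_of_gt hu))).continuousWithinAt

theorem aestronglyMeasurable_logKernel (hK : 0 < K) :
    AEStronglyMeasurable (logKernel H K) (volume.restrict (Ioi 0)) :=
  (continuousOn_logKernel hpos hK).aestronglyMeasurable measurableSet_Ioi

theorem integrableOn_logKernel_Ioc (h0 : X ^ 2 ∣ H) (hK : 0 < K) (b : ℝ) :
    IntegrableOn (logKernel H K) (Ioc 0 b) := by
  obtain ⟨Q, rfl⟩ := h0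
  have hbound : IntegrableOn (fun u ↦ Q.eval u / K) (Ioc 0 b) :=
    ((Q.continuous.div_const K).integrableOn_Icc).mono_set Ioc_subset_Icc_self
  refine Integrable.mono' hbound
    ((aestronglyMeasurable_logKernel hpos hK).mono_set Ioc_subset_Ioi_self) ?_
  refine (ae_restrict_iff' measurableSet_Ioc).2 (Eventually.of_forall fun u hu ↦ ?_)
  have hH := hpos u hu.1
  have hu2 : 0 < u ^ 2 := pow_pos hu.1 2
  rw [Real.norm_of_nonneg (logKernel_nonneg hH.le hK), logKernel, div_le_iff₀ hu2]
  refine (Real.log_le_sub_one_of_pos (by positivity)).trans (le_of_eq ?_)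
  simp only [eval_mul, eval_pow, eval_X]
  ring

theorem log_one_add_eval_div_isBigO (hK : 0 < K) :
    (fun u ↦ Real.log (1 + H.eval u / K)) =O[atTop] fun u : ℝ ↦ u ^ (1 / 2 : ℝ) := by
  set k := H.natDegree + 1
  have hk : (0 : ℝ) < k := Nat.cast_pos.2 H.natDegree.succ_pos
  have hpoly : (fun u ↦ 1 + H.eval u / K) =O[atTop] fun u : ℝ ↦ u ^ k := by
    have hdeg : H.degree ≤ (X ^ k : ℝ[X]).degree := by
      rw [degree_X_pow]
      exact degree_le_natDegree.trans (Nat.cast_le.2 (Nat.le_succ _))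
    refine IsBigO.add (isLittleO_const_left.2 (.inr ?_)).isBigO ?_
    · exact tendsto_norm_atTop_atTop.comp (tendsto_pow_atTop H.natDegree.succ_ne_zero)
    · simpa only [div_eq_inv_mul, eval_pow, eval_X] using
        (H.isBigO_atTop_of_degree_le _ hdeg).const_mul_left K⁻¹
  have hroot := hpoly.rpow (r := (2 * k : ℝ)⁻¹) (by positivity)
    ((eventually_ge_atTop 0).mono fun u hu ↦ pow_nonneg hu k)
  have hlog : (fun u ↦ Real.log (1 + H.eval u / K)) =O[atTop]
      fun u ↦ (1 + H.eval u / K) ^ (2 * k : ℝ)⁻¹ := by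
    refine IsBigO.of_bound (2 * k) ((eventually_gt_atTop 0).mono fun u hu ↦ ?_)
    have hH : 0 ≤ H.eval u / K := div_nonneg (hpos u hu).le hK.le
    rw [Real.norm_of_nonneg (Real.log_nonneg (le_add_of_nonneg_right hH)),
      Real.norm_of_nonneg (by positivity), mul_comm]
    simpa only [div_inv_eq_mul] using
      Real.log_le_rpow_div (add_nonneg zero_le_one hH) (by positivity : 0 < (2 * k : ℝ)⁻¹)
  refine (hlog.trans hroot).trans_eventuallyEq ((eventually_ge_atTop 0).mono fun u hu ↦ ?_)
  beta_reduce
  rw [← Real.rpow_natCast_mul hu]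
  congr 1
  field_simp

theorem logKernel_isBigO_rpow (hK : 0 < K) :
    logKernel H K =O[atTop] fun u ↦ u ^ (-(3 / 2) : ℝ) := by
  refine ((log_one_add_eval_div_isBigO hpos hK).mul
    (isBigO_refl (fun u : ℝ ↦ (u ^ 2)⁻¹) atTop)).trans_eventuallyEq
    ((eventually_gt_atTop 0).mono fun u hu ↦ ?_)
  beta_reduce
  rw [← Real.rpow_natCast, ← Real.rpow_neg hu.le, ← Real.rpow_add hu]
  norm_num

theorem integrableOn_logKernel (h0 : X ^ 2 ∣ H) (hK : 0 < K) :
    IntegrableOn (logKernel H K) (Ioi 0) := by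
  rw [← Ioc_union_Ioi_eq_Ioi zero_le_one]
  refine (integrableOn_logKernel_Ioc hpos h0 hK 1).union ?_
  have hloc : LocallyIntegrableOn (logKernel H K) (Ici 1) :=
    ((continuousOn_logKernel hpos hK).mono (Ici_subset_Ioi.2 one_pos)).locallyIntegrableOn
      measurableSet_Ici
  exact (hloc.integrableOn_of_isBigO_atTop (logKernel_isBigO_rpow hpos hK)
    ⟨Ioi 1, Ioi_mem_atTop 1, integrableOn_Ioi_rpow_of_lt (by norm_num) one_pos⟩).mono_set
      Ioi_subset_Ici_self

theorem tendsto_integral_logKernel (h0 : X ^ 2 ∣ H) {K₀ : ℝ} (hK₀ : 0 < K₀) {l : Filter ℝ}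
    [l.IsCountablyGenerated] (hl : ∀ᶠ K in l, K₀ ≤ K) {g : ℝ → ℝ}
    (hg : ∀ u, 0 < u → Tendsto (fun K ↦ logKernel H K u) l (𝓝 (g u))) :
    Tendsto (fun K ↦ ∫ u in Ioi 0, logKernel H K u) l (𝓝 (∫ u in Ioi 0, g u)) := by
  refine tendsto_integral_filter_of_dominated_convergence (logKernel H K₀)
    (hl.mono fun K hK ↦ aestronglyMeasurable_logKernel hpos (hK₀.trans_le hK))
    (hl.mono fun K hK ↦ ?_) (integrableOn_logKernel hpos h0 hK₀)
    ((ae_restrict_iff' measurableSet_Ioi).2 (Eventually.of_forall hg))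
  refine (ae_restrict_iff' measurableSet_Ioi).2 (Eventually.of_forall fun u hu ↦ ?_)
  rw [Real.norm_of_nonneg (logKernel_nonneg (hpos u hu).le (hK₀.trans_le hK))]
  exact logKernel_anti (hpos u hu).le hK₀ hK

theorem continuousOn_integral_logKernel (h0 : X ^ 2 ∣ H) :
    ContinuousOn (fun K ↦ ∫ u in Ioi 0, logKernel H K u) (Ioi 0) := fun _ hK ↦
  (tendsto_integral_logKernel hpos h0 (half_pos hK)
    ((lt_mem_nhds (half_lt_self hK)).mono fun _ ↦ le_of_lt) fun u hu ↦
      continuousAt_logKernel_left (hpos u hu).le hK).mono_left nhdsWithin_le_nhds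

theorem tendsto_integral_logKernel_atTop (h0 : X ^ 2 ∣ H) :
    Tendsto (fun K ↦ ∫ u in Ioi 0, logKernel H K u) atTop (𝓝 0) := by
  simpa only [integral_zero] using tendsto_integral_logKernel hpos h0 one_pos
    (eventually_ge_atTop 1) fun u _ ↦ tendsto_logKernel_atTop H u

theorem strictAntiOn_integral_logKernel (h0 : X ^ 2 ∣ H) :
    StrictAntiOn (fun K ↦ ∫ u in Ioi 0, logKernel H K u) (Ioi 0) := by
  intro K hK K' hK' hKK'
  have hi := integrableOn_logKernel hpos h0 hK
  have hi' := integrableOn_logKernel hpos h0 hK'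
  have hlt (u : ℝ) (hu : u ∈ Ioi 0) : logKernel H K' u < logKernel H K u :=
    logKernel_strictAnti (hpos u hu) hu hK hKK'
  have hsupp : Ioi 0 ⊆ Function.support (logKernel H K - logKernel H K') :=
    fun u hu ↦ (sub_pos.2 (hlt u hu)).ne'
  rw [← sub_pos, ← integral_sub' hi hi', setIntegral_pos_iff_support_of_nonneg_ae ?_ (hi.sub hi'),
    inter_eq_right.2 hsupp, Real.volume_Ioi]
  · exact ENNReal.zero_lt_top
  · exact (ae_restrict_iff' measurableSet_Ioi).2
      (Eventually.of_forall fun u hu ↦ (sub_pos.2 (hlt u hu)).le)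

theorem log_div_four_le_integral_logKernel (h0 : X ^ 2 ∣ H) (hK : 0 < K) {m : ℝ} (hm : 0 ≤ m)
    (hmH : ∀ u ∈ Ioc 1 2, m ≤ H.eval u) :
    Real.log (1 + m / K) / 4 ≤ ∫ u in Ioi 0, logKernel H K u := by
  have hi := integrableOn_logKernel hpos h0 hK
  have hsub : Ioc (1 : ℝ) 2 ⊆ Ioi 0 := Ioc_subset_Ioi_self.trans (Ioi_subset_Ioi zero_le_one)
  calc Real.log (1 + m / K) / 4 = ∫ _ in Ioc (1 : ℝ) 2, Real.log (1 + m / K) / 2 ^ 2 := by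
        simp only [integral_const, measureReal_restrict_apply_univ, Real.volume_real_Ioc]
        norm_num
    _ ≤ ∫ u in Ioc (1 : ℝ) 2, logKernel H K u := by
        refine setIntegral_mono_on (by simp) (hi.mono_set hsub) measurableSet_Ioc fun u hu ↦ ?_
        have hu0 : 0 < u := zero_lt_one.trans hu.1
        have hlog : 0 ≤ Real.log (1 + m / K) :=
          Real.log_nonneg (le_add_of_nonneg_right (by positivity))
        have := hmH u hu
        unfold logKernel
        gcongr
        exacts [hlog.trans (Real.log_le_log (by positivity) (by gcongr)), hu.2]
    _ ≤ ∫ u in Ioi 0, logKernel H K u :=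
        setIntegral_mono_set hi ((ae_restrict_iff' measurableSet_Ioi).2
          (Eventually.of_forall fun u hu ↦ logKernel_nonneg (hpos u hu).le hK)) hsub.eventuallyLE

theorem existsUnique_integral_logKernel_eq (h0 : X ^ 2 ∣ H) {s : ℝ} (hs : 0 < s) :
    ∃! K, 0 < K ∧ ∫ u in Ioi 0, logKernel H K u = s := by
  have hlarge : ∃ K, 0 < K ∧ s ≤ ∫ u in Ioi 0, logKernel H K u := by
    obtain ⟨w, hw, hmin⟩ := isCompact_Icc.exists_isMinOn (nonempty_Icc.2 one_le_two)
      (H.continuousOn (s := Icc (1 : ℝ) 2))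
    have hm : 0 < H.eval w := hpos w (zero_lt_one.trans_le hw.1)
    refine ⟨H.eval w / Real.exp (4 * s), by positivity, ?_⟩
    refine le_trans ?_ (log_div_four_le_integral_logKernel hpos h0 (by positivity) hm.le
      fun u hu ↦ hmin (Ioc_subset_Icc_self hu))
    rw [div_div_cancel₀ hm.ne', le_div_iff₀ four_pos, Real.le_log_iff_exp_le (by positivity),
      mul_comm]
    exact le_add_of_nonneg_left zero_le_one
  obtain ⟨K₁, hK₁, h₁⟩ := hlarge
  obtain ⟨K₂, h₂, hK₂⟩ := (((tendsto_integral_logKernel_atTop hpos h0).eventually_le_const hs).and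
    (eventually_ge_atTop K₁)).exists
  obtain ⟨K, hK, hKs⟩ := intermediate_value_Icc' hK₂
    ((continuousOn_integral_logKernel hpos h0).mono fun _ h ↦ hK₁.trans_le h.1) ⟨h₂, h₁⟩
  have hK0 : 0 < K := hK₁.trans_le hK.1
  exact ⟨K, ⟨hK0, hKs⟩, fun K' hK' ↦
    (strictAntiOn_integral_logKernel hpos h0).injOn hK'.1 hK0 (hK'.2.trans hKs.symm)⟩

end LogKernel

section Calibration

theorem exists_hasDerivAt_leftInverse {A A' : ℝ → ℝ} (hA : ∀ p, HasStrictDerivAt A (A' p) p)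
    (hA' : ∀ p, 0 < A' p) : ∃ B : ℝ → ℝ, ∀ p, B (A p) = p ∧ HasDerivAt B (A' p)⁻¹ (A p) := by
  have hinj : Function.Injective A :=
    (strictMono_of_hasDerivAt_pos (fun p ↦ (hA p).hasDerivAt) hA').injective
  have hBA := Function.leftInverse_invFun hinj
  refine ⟨Function.invFun A, fun p ↦ ⟨hBA p, ?_⟩⟩
  have hnhds : map A (𝓝 p) = 𝓝 (A p) := (hA p).map_nhds_eq (hA' p).ne'
  have hcont : ContinuousAt (Function.invFun A) (A p) := by
    rw [ContinuousAt, ← hnhds, tendsto_map'_iff, hBA.comp_eq_id, hBA p]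
    exact tendsto_id
  refine HasDerivAt.of_local_left_inverse hcont (by rw [hBA p]; exact (hA p).hasDerivAt)
    (hA' p).ne' ?_
  rw [← hnhds, eventually_map]
  exact Eventually.of_forall fun q ↦ congrArg A (hBA q)

namespace IsLagrangian

variable {L : ℝ[X]} (hL : IsLagrangian L) {K : ℝ}

/-- The time the solution of `p' = H(p) + K` with `p = 0` at time `0` needs to reach the value `p`,
where `H` is the Hamiltonian as a function of the momentum. -/
noncomputable def travelTime (K p : ℝ) : ℝ :=
  ∫ q in 0..p, ((hamiltonian L).eval (hL.momentumIso.symm q) + K)⁻¹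

theorem travelTime_neg (p : ℝ) : hL.travelTime K (-p) = -hL.travelTime K p := by
  have h := intervalIntegral.integral_comp_neg (a := -p) (b := 0)
    fun q ↦ ((hamiltonian L).eval (hL.momentumIso.symm q) + K)⁻¹
  rw [neg_neg, neg_zero] at h
  rw [travelTime, travelTime, ← h, intervalIntegral.integral_symm]
  simp only [hL.momentumIso_symm_neg, hL.eval_hamiltonian_neg]

include hL

theorem eval_hamiltonian_pos {u : ℝ} (hu : 0 < u) : 0 < (hamiltonian L).eval u :=
  (hL.eval_hamiltonian_nonneg 0).trans_lt
    (hL.strictMonoOn_hamiltonian self_mem_Ici (mem_Ici.2 hu.le) hu)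

theorem eval_hamiltonian_add_pos (hK : 0 < K) (u : ℝ) : 0 < (hamiltonian L).eval u + K :=
  add_pos_of_nonneg_of_pos (hL.eval_hamiltonian_nonneg u) hK

theorem hasStrictDerivAt_travelTime (hK : 0 < K) (p : ℝ) :
    HasStrictDerivAt (hL.travelTime K)
      ((hamiltonian L).eval (hL.momentumIso.symm p) + K)⁻¹ p := by
  have hcont : Continuous fun q ↦ ((hamiltonian L).eval (hL.momentumIso.symm q) + K)⁻¹ :=
    (((hamiltonian L).continuous.comp hL.momentumIso.symm.continuous).add
      continuous_const).inv₀ fun q ↦ (hL.eval_hamiltonian_add_pos hK _).ne'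
  exact hcont.integral_hasStrictDerivAt 0 p

theorem hasDerivAt_log_one_add_hamiltonian_div (hK : 0 < K) (u : ℝ) :
    HasDerivAt (fun u ↦ Real.log (1 + (hamiltonian L).eval u / K))
      (u * ((derivative (derivative L)).eval u * ((hamiltonian L).eval u + K)⁻¹)) u := by
  have hpos := hL.eval_hamiltonian_add_pos hK u
  have hfrac : 1 + (hamiltonian L).eval u / K = ((hamiltonian L).eval u + K) / K := by
    rw [add_div, div_self hK.ne', add_comm]
  refine ((((hamiltonian L).hasDerivAt u).div_const K).const_add 1 |>.log ?_).congr_deriv ?_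
  · rw [hfrac]
    positivity
  · rw [hfrac, derivative_hamiltonian, eval_mul, eval_X, div_div_div_cancel_right₀ hK.ne']
    ring

theorem hasDerivAt_travelTime_momentum (hK : 0 < K) (u : ℝ) :
    HasDerivAt (fun u ↦ hL.travelTime K ((derivative L).eval u))
      ((derivative (derivative L)).eval u * ((hamiltonian L).eval u + K)⁻¹) u := by
  have h := (hL.hasStrictDerivAt_travelTime hK ((derivative L).eval u)).hasDerivAt
  rw [← hL.momentumIso_apply, OrderIso.symm_apply_apply] at h
  rw [mul_comm]
  exact h.comp u ((derivative L).hasDerivAt u)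

/-- Since `H'(u) = u L''(u)`, the two terms with `L''(u)` cancel. -/
theorem hasDerivAt_travelTime_momentum_sub_log_div (hK : 0 < K) {u : ℝ} (hu : u ≠ 0) :
    HasDerivAt (fun u ↦ hL.travelTime K ((derivative L).eval u) -
      Real.log (1 + (hamiltonian L).eval u / K) / u) (logKernel (hamiltonian L) K u) u := by
  refine ((hL.hasDerivAt_travelTime_momentum hK u).sub
    ((hL.hasDerivAt_log_one_add_hamiltonian_div hK u).div (hasDerivAt_id u) hu)).congr_deriv ?_
  simp only [logKernel, id]
  field_simp
  ring

theorem travelTime_momentum_eq (hK : 0 < K) {M : ℝ} (hM : 0 < M) :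
    hL.travelTime K ((derivative L).eval M) =
      Real.log (1 + (hamiltonian L).eval M / K) / M
        + ∫ u in 0..M, logKernel (hamiltonian L) K u := by
  set F : ℝ → ℝ := fun u ↦ Real.log (1 + (hamiltonian L).eval u / K) with hF
  have hFderiv := hL.hasDerivAt_log_one_add_hamiltonian_div hK
  have hF0 : F 0 = 0 := by
    simp [hF, eval_hamiltonian, hL.zero]
  have hslope {u : ℝ} (hu : u ≠ 0) : dslope F 0 u = F u / u := by
    rw [dslope_of_ne _ hu, slope_def_field, hF0, sub_zero, sub_zero]
  have hcont : ContinuousOn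
      (fun u ↦ hL.travelTime K ((derivative L).eval u) - dslope F 0 u) (Icc 0 M) := by
    intro u _
    have hdslope : ContinuousAt (dslope F 0) u := by
      rcases eq_or_ne u 0 with rfl | hu
      · exact continuousAt_dslope_same.2 (hFderiv 0).differentiableAt
      · exact (continuousAt_dslope_of_ne hu).2 (hFderiv u).continuousAt
    exact ((hL.hasDerivAt_travelTime_momentum hK u).continuousAt.sub hdslope).continuousWithinAt
  have hderiv (u : ℝ) (hu : u ∈ Ioo 0 M) :
      HasDerivAt (fun u ↦ hL.travelTime K ((derivative L).eval u) - dslope F 0 u)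
        (logKernel (hamiltonian L) K u) u :=
    (hL.hasDerivAt_travelTime_momentum_sub_log_div hK hu.1.ne').congr_of_eventuallyEq
      ((eventually_ne_nhds hu.1.ne').mono fun w hw ↦ congrArg _ (hslope hw))
  have hint : IntervalIntegrable (logKernel (hamiltonian L) K) volume 0 M := by
    rw [intervalIntegrable_iff_integrableOn_Ioc_of_le hM.le]
    exact integrableOn_logKernel_Ioc (fun u ↦ hL.eval_hamiltonian_pos) hL.X_sq_dvd_hamiltonian hK M
  have hzero : hL.travelTime K ((derivative L).eval 0) - dslope F 0 0 = 0 := by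
    rw [dslope_same, (hFderiv 0).deriv, hL.eval_derivative_zero, travelTime,
      intervalIntegral.integral_same, zero_mul, sub_zero]
  rw [intervalIntegral.integral_eq_sub_of_hasDerivAt_of_le hM.le hcont hderiv hint, hzero,
    hslope hM.ne']
  ring

theorem exists_lt_travelTime (hK : 0 < K) {s : ℝ}
    (hs : s < ∫ u in Ioi 0, logKernel (hamiltonian L) K u) : ∃ p, s < hL.travelTime K p := by
  have hint := integrableOn_logKernel (fun u ↦ hL.eval_hamiltonian_pos)
    hL.X_sq_dvd_hamiltonian hK
  obtain ⟨M, hsM, hM⟩ := (((intervalIntegral_tendsto_integral_Ioi 0 hint tendsto_id).eventually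
    (lt_mem_nhds hs)).and (eventually_gt_atTop 0)).exists
  refine ⟨(derivative L).eval M, hsM.trans_le ?_⟩
  rw [hL.travelTime_momentum_eq hK hM]
  refine le_add_of_nonneg_left (div_nonneg (Real.log_nonneg (le_add_of_nonneg_right ?_)) hM.le)
  exact div_nonneg (hL.eval_hamiltonian_nonneg M) hK.le

/-- `p` solves the Hamilton–Jacobi equation `p' = H(p) + K`. -/
theorem exists_calibration (hK : 0 < K) {s : ℝ}
    (hs : s < ∫ u in Ioi 0, logKernel (hamiltonian L) K u) :
    ∃ p p' : ℝ → ℝ, ∀ y ∈ Icc (-s) s, HasDerivAt p (p' y) y ∧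
      ∀ u, p y * u - p' y ≤ L.eval u - K := by
  obtain ⟨P, hP⟩ := hL.exists_lt_travelTime hK hs
  have hderiv := hL.hasStrictDerivAt_travelTime hK
  obtain ⟨B, hB⟩ := exists_hasDerivAt_leftInverse hderiv
    fun p ↦ inv_pos.2 (hL.eval_hamiltonian_add_pos hK _)
  refine ⟨B, fun y ↦ (hamiltonian L).eval (hL.momentumIso.symm (B y)) + K, fun y hy ↦ ?_⟩
  have hcont : Continuous (hL.travelTime K) :=
    continuous_iff_continuousAt.2 fun p ↦ (hderiv p).hasDerivAt.continuousAt
  obtain ⟨p, rfl⟩ : y ∈ range (hL.travelTime K) := by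
    refine mem_range_of_exists_le_of_exists_ge hcont ⟨-P, ?_⟩ ⟨P, hy.2.trans hP.le⟩
    rw [hL.travelTime_neg]
    exact (neg_le_neg hP.le).trans hy.1
  obtain ⟨hBp, hBderiv⟩ := hB p
  rw [inv_inv] at hBderiv
  simp only [hBp]
  refine ⟨hBderiv, fun u ↦ ?_⟩
  have := hL.fenchel_inequality p u
  linarith

end IsLagrangian

end Calibration

section Energy

variable {l : ℕ} {c : ℕ → ℝ}

/-- The even polynomial `∑ₕ c_h u^{2h}`, `1 ≤ h ≤ l`. -/
noncomputable def lagrangian (l : ℕ) (c : ℕ → ℝ) : ℝ[X] :=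
  ∑ h ∈ Finset.Icc 1 l, C (c h) * X ^ (2 * h)

/-- The homogeneous form of degree `2l` in `(z, y)` which extends `lagrangian l c` (its value at
`y = 1`). -/
noncomputable def energy (l : ℕ) (c : ℕ → ℝ) (z y : ℝ) : ℝ :=
  ∑ h ∈ Finset.Icc 1 l, c h * (z ^ (2 * h) * y ^ (2 * l - 2 * h))

theorem eval_lagrangian (l : ℕ) (c : ℕ → ℝ) (u : ℝ) :
    (lagrangian l c).eval u = ∑ h ∈ Finset.Icc 1 l, c h * u ^ (2 * h) := by
  simp only [lagrangian, eval_finsetSum, eval_mul, eval_C, eval_pow, eval_X]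

theorem eval_hamiltonian_lagrangian (l : ℕ) (c : ℕ → ℝ) (u : ℝ) :
    (hamiltonian (lagrangian l c)).eval u =
      ∑ h ∈ Finset.Icc 1 l, (2 * h - 1) * c h * u ^ (2 * h) := by
  rw [eval_hamiltonian, lagrangian, derivative_sum, eval_finsetSum, eval_finsetSum,
    Finset.mul_sum, ← Finset.sum_sub_distrib]
  refine Finset.sum_congr rfl fun h hh ↦ ?_
  have hpow : u ^ (2 * h) = u * u ^ (2 * h - 1) := by
    rw [← pow_succ']
    congr 1
    have := (Finset.mem_Icc.1 hh).1
    omega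
  simp only [derivative_mul, derivative_C, derivative_X_pow, eval_mul, eval_C, eval_pow,
    eval_X, hpow, zero_mul, zero_add]
  push_cast
  ring

theorem isLagrangian_lagrangian
    (hmono : StrictMonoOn (fun u ↦ (hamiltonian (lagrangian l c)).eval u) (Ici 0)) :
    IsLagrangian (lagrangian l c) where
  zero := by
    rw [eval_lagrangian]
    refine Finset.sum_eq_zero fun h hh ↦ ?_
    have := (Finset.mem_Icc.1 hh).1
    rw [zero_pow (by omega), mul_zero]
  even u := by
    simp only [eval_lagrangian, pow_mul, neg_sq]
  strictMonoOn_hamiltonian := hmono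

theorem IsLagrangian.exists_coeff_ne_zero (hL : IsLagrangian (lagrangian l c)) :
    ∃ h ∈ Finset.Icc 1 l, c h ≠ 0 := by
  by_contra! hc
  have hpos := hL.eval_hamiltonian_pos one_pos
  rw [eval_hamiltonian_lagrangian,
    Finset.sum_eq_zero fun h hh ↦ by rw [hc h hh, mul_zero, zero_mul]] at hpos
  exact hpos.false

theorem IsLagrangian.one_le (hL : IsLagrangian (lagrangian l c)) : 1 ≤ l := by
  obtain ⟨h, hh, -⟩ := hL.exists_coeff_ne_zero
  exact Finset.nonempty_Icc.1 ⟨h, hh⟩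

theorem energy_zero_left (l : ℕ) (c : ℕ → ℝ) (y : ℝ) : energy l c 0 y = 0 := by
  refine Finset.sum_eq_zero fun h hh ↦ ?_
  have := (Finset.mem_Icc.1 hh).1
  rw [zero_pow (by omega), zero_mul, mul_zero]

theorem energy_eq {y : ℝ} (hy : y ≠ 0) (z : ℝ) :
    energy l c z y = y ^ (2 * l) * (lagrangian l c).eval (z / y) := by
  rw [energy, eval_lagrangian, Finset.mul_sum]
  refine Finset.sum_congr rfl fun h hh ↦ ?_
  have hpow : y ^ (2 * l) = y ^ (2 * h) * y ^ (2 * l - 2 * h) := by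
    rw [← pow_add]
    congr 1
    have := (Finset.mem_Icc.1 hh).2
    omega
  rw [hpow, div_pow]
  field_simp

theorem continuous_energy {g f : ℝ → ℝ} (hg : Continuous g) (hf : Continuous f) :
    Continuous fun t ↦ energy l c (g t) (f t) := by
  unfold energy
  fun_prop

theorem energy_le_energy (hL : IsLagrangian (lagrangian l c)) {z w : ℝ} (h : |z| ≤ |w|) (y : ℝ) :
    energy l c z y ≤ energy l c w y := by
  have hclosed : IsClosed {y | energy l c z y ≤ energy l c w y} :=
    isClosed_le (continuous_energy continuous_const continuous_id)
      (continuous_energy continuous_const continuous_id)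
  refine (dense_compl_singleton (0 : ℝ)).induction (fun y (hy : y ≠ 0) ↦ ?_) hclosed y
  rw [energy_eq hy, energy_eq hy]
  refine mul_le_mul_of_nonneg_left (hL.eval_le_eval_of_abs_le ?_)
    ((even_two_mul l).pow_nonneg y)
  rw [abs_div, abs_div]
  gcongr

theorem energy_nonneg (hL : IsLagrangian (lagrangian l c)) (z y : ℝ) : 0 ≤ energy l c z y := by
  rw [← energy_zero_left l c y]
  exact energy_le_energy hL (by simp) y

theorem le_energy_of_calibration (hL : IsLagrangian (lagrangian l c)) {q q' K : ℝ}
    (hq : ∀ u, q * u - q' ≤ (lagrangian l c).eval u - K) (z y : ℝ) :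
    q * (z * y ^ (2 * l - 1)) - q' * y ^ (2 * l) ≤ energy l c z y - K * y ^ (2 * l) := by
  have hl := hL.one_le
  rcases eq_or_ne y 0 with rfl | hy
  · rw [zero_pow (by omega), zero_pow (by omega)]
    simpa using energy_nonneg hL z 0
  · have hpow : y ^ (2 * l) = y * y ^ (2 * l - 1) := by
      rw [← pow_succ']
      congr 1
      omega
    calc q * (z * y ^ (2 * l - 1)) - q' * y ^ (2 * l) = y ^ (2 * l) * (q * (z / y) - q') := by
          rw [hpow]
          field_simp
      _ ≤ y ^ (2 * l) * ((lagrangian l c).eval (z / y) - K) :=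
          mul_le_mul_of_nonneg_left (hq _) ((even_two_mul l).pow_nonneg y)
      _ = energy l c z y - K * y ^ (2 * l) := by
          rw [energy_eq hy]
          ring

theorem hasDerivAt_mul_comp_mul_pow {p f : ℝ → ℝ} {q' κ r t : ℝ} (hl : l ≠ 0) (hκ : κ ≠ 0)
    (hp : HasDerivAt p q' (l * ((r - 2 * t) / κ))) (hf : DifferentiableAt ℝ f t) :
    HasDerivAt (fun t ↦ κ / (2 * l) * p (l * ((r - 2 * t) / κ)) * f t ^ (2 * l))
      (p (l * ((r - 2 * t) / κ)) * (κ * deriv f t * f t ^ (2 * l - 1)) - q' * f t ^ (2 * l)) t := by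
  have hinner : HasDerivAt (fun t ↦ l * ((r - 2 * t) / κ)) (l * (-(2 * 1) / κ)) t :=
    ((((hasDerivAt_id t).const_mul 2).const_sub r).div_const κ).const_mul _
  refine (((hp.comp t hinner).const_mul (κ / (2 * l))).mul
    (hf.hasDerivAt.pow (2 * l))).congr_deriv ?_
  simp only [Function.comp_apply, Pi.pow_apply]
  push_cast
  field_simp
  ring

/-- For a calibration `p` of the Lagrangian, the function `W` below vanishes at both ends of
`[a, b]`, and its derivative is at most `energy (κ f') f - K f^{2l}`. -/
theorem mul_integral_pow_le_integral_energy (hL : IsLagrangian (lagrangian l c)) {K : ℝ}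
    (hK : 0 < K) {f : ℝ → ℝ} (hf : ContDiff ℝ 1 f) {a b κ : ℝ} (hab : a ≤ b) (hfa : f a = 0)
    (hfb : f b = 0) (hκ : 0 < κ)
    (hlen : l * ((b - a) / κ) < ∫ u in Ioi 0, logKernel (hamiltonian (lagrangian l c)) K u) :
    K * ∫ t in a..b, f t ^ (2 * l) ≤ ∫ t in a..b, energy l c (κ * deriv f t) (f t) := by
  have hl : l ≠ 0 := by have := hL.one_le; omega
  obtain ⟨p, p', hp⟩ := hL.exists_calibration hK hlen
  set y : ℝ → ℝ := fun t ↦ l * ((a + b - 2 * t) / κ) with hy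
  have hmem (t : ℝ) (ht : t ∈ Icc a b) :
      y t ∈ Icc (-(l * ((b - a) / κ))) (l * ((b - a) / κ)) := by
    rw [hy, ← mul_neg, ← neg_div]
    constructor <;> refine mul_le_mul_of_nonneg_left (div_le_div_of_nonneg_right ?_ hκ.le)
      l.cast_nonneg <;> linarith [ht.1, ht.2]
  set W : ℝ → ℝ := fun t ↦ κ / (2 * l) * p (y t) * f t ^ (2 * l)
  have hW (t : ℝ) (ht : t ∈ Icc a b) : HasDerivAt W
      (p (y t) * (κ * deriv f t * f t ^ (2 * l - 1)) - p' (y t) * f t ^ (2 * l)) t :=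
    hasDerivAt_mul_comp_mul_pow hl hκ.ne' (hp _ (hmem t ht)).1 (hf.differentiable one_ne_zero t)
  have hE : Continuous fun t ↦ energy l c (κ * deriv f t) (f t) :=
    continuous_energy (continuous_const.mul (hf.continuous_deriv le_rfl)) hf.continuous
  have hpow : Continuous fun t ↦ K * f t ^ (2 * l) := (hf.continuous.pow _).const_mul K
  have hmain := intervalIntegral.sub_le_integral_of_hasDeriv_right_of_le hab
    (fun t ht ↦ (hW t ht).continuousAt.continuousWithinAt)
    (fun t ht ↦ (hW t (Ioo_subset_Icc_self ht)).hasDerivWithinAt)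
    (φ := fun t ↦ energy l c (κ * deriv f t) (f t) - K * f t ^ (2 * l))
    (hE.sub hpow).integrableOn_Icc
    (fun t ht ↦ le_energy_of_calibration hL (hp _ (hmem t (Ioo_subset_Icc_self ht))).2 _ _)
  have hends : W b - W a = 0 := by
    simp only [W, hfa, hfb, zero_pow (mul_ne_zero two_ne_zero hl), mul_zero, sub_zero]
  rw [hends, intervalIntegral.integral_sub (hE.intervalIntegrable _ _)
    (hpow.intervalIntegrable _ _), intervalIntegral.integral_const_mul] at hmain
  exact sub_nonneg.1 hmain

end Energy

section Coefficients

variable {l : ℕ} {v : ℕ → ℝ}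

/-- The coefficients `(2l-1)/(2h-1) binom(l,h) v_h` of the Lagrangian whose Hamiltonian is `G`. -/
noncomputable def coef (l : ℕ) (v : ℕ → ℝ) (h : ℕ) : ℝ :=
  (2 * (l : ℝ) - 1) / (2 * (h : ℝ) - 1) * (l.choose h : ℝ) * v h

theorem two_mul_cast_sub_one_pos {m : ℕ} (hm : 1 ≤ m) : 0 < 2 * (m : ℝ) - 1 := by
  have : (1 : ℝ) ≤ m := Nat.one_le_cast.2 hm
  linarith

theorem eval_hamiltonian_coef (l : ℕ) (v : ℕ → ℝ) (u : ℝ) :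
    (hamiltonian (lagrangian l (coef l v))).eval u = G l v u := by
  rw [eval_hamiltonian_lagrangian, G, Finset.mul_sum]
  refine Finset.sum_congr rfl fun h hh ↦ ?_
  have := (two_mul_cast_sub_one_pos (Finset.mem_Icc.1 hh).1).ne'
  rw [coef]
  field_simp

theorem isLagrangian_coef (hG : StrictMonoOn (G l v) (Ici 0)) :
    IsLagrangian (lagrangian l (coef l v)) :=
  isLagrangian_lagrangian (by simpa only [eval_hamiltonian_coef] using hG)

theorem isLambda_iff (hl : 1 ≤ l) {lam : ℝ} : IsLambda l v lam ↔
    0 < (2 * (l : ℝ) - 1) * lam ∧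
      ∫ u in Ioi 0, logKernel (hamiltonian (lagrangian l (coef l v))) ((2 * (l : ℝ) - 1) * lam) u
        = l * Real.pi := by
  simp only [IsLambda, logKernel, eval_hamiltonian_coef,
    mul_pos_iff_of_pos_left (two_mul_cast_sub_one_pos hl)]

theorem existsUnique_isLambda (hG : StrictMonoOn (G l v) (Ici 0)) : ∃! lam, IsLambda l v lam := by
  have hL := isLagrangian_coef hG
  have hl : 1 ≤ l := hL.one_le
  have hK := existsUnique_integral_logKernel_eq (fun _ ↦ hL.eval_hamiltonian_pos)
    hL.X_sq_dvd_hamiltonian (by positivity : 0 < l * Real.pi)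
  simpa only [isLambda_iff hl, Equiv.mulLeft₀_apply] using
    (Equiv.mulLeft₀ _ (two_mul_cast_sub_one_pos hl).ne').bijective.existsUnique_iff.1 hK

end Coefficients

section AnalyticZeros

variable {f : ℝ → ℝ}

theorem zeroCount_mono (f : ℝ → ℝ) : Monotone (zeroCount f) := fun _ _ hxy ↦
  encard_le_encard fun _ hp ↦ ⟨hp.1, hp.2.1.trans hxy, hp.2.2⟩

theorem eq_zero_of_lt_analyticOrderAt {z : ℝ} {r : ℕ} (h : r < analyticOrderAt f z) : f z = 0 :=
  apply_eq_zero_of_analyticOrderAt_ne_zero (zero_le.trans_lt h).ne'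

variable (hf : ∀ t, AnalyticAt ℝ f t)
include hf

theorem exists_lt_zeroCount (hinf : {t : ℝ | 0 ≤ t ∧ f t = 0}.Infinite) (k : ℕ) :
    ∃ x, k < zeroCount f x := by
  obtain ⟨s, hs, hcard⟩ := hinf.exists_subset_card_eq (k + 1)
  obtain ⟨x, hx⟩ := s.bddAbove
  have hsub : (fun z : ℝ ↦ (z, 0)) '' (s : Set ℝ) ⊆
      {p : ℝ × ℕ | 0 ≤ p.1 ∧ p.1 ≤ x ∧ (p.2 : ℕ∞) < analyticOrderAt f p.1} := by
    rintro _ ⟨z, hz, rfl⟩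
    refine ⟨(hs hz).1, hx hz, ?_⟩
    simp only [Nat.cast_zero]
    rw [pos_iff_ne_zero, (hf z).analyticOrderAt_ne_zero]
    exact (hs hz).2
  have hle := encard_le_encard hsub
  rw [Function.Injective.encard_image (fun _ _ h ↦ congrArg Prod.fst h),
    encard_coe_eq_coe_finsetCard, hcard] at hle
  exact ⟨x, (Nat.cast_lt.2 k.lt_succ_self).trans_le hle⟩

variable (hf0 : ∃ t, f t ≠ 0)
include hf0

theorem eventually_nhdsNE_ne_zero (t : ℝ) : ∀ᶠ s in 𝓝[≠] t, f s ≠ 0 := by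
  by_contra h
  obtain ⟨u, hu⟩ := hf0
  exact hu (AnalyticOnNhd.eqOn_zero_of_preconnected_of_frequently_eq_zero (fun x _ ↦ hf x)
    isPreconnected_univ (mem_univ t) (not_eventually.1 h |>.mono fun _ ↦ not_not.1) (mem_univ u))

theorem analyticOrderAt_ne_top (t : ℝ) : analyticOrderAt f t ≠ ⊤ := by
  rw [Ne, analyticOrderAt_eq_top]
  intro h
  obtain ⟨s, hs, hs0⟩ := ((eventually_nhdsNE_ne_zero hf hf0 t).and
    (h.filter_mono nhdsWithin_le_nhds)).exists
  exact hs hs0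

theorem finite_zeros_Icc (a b : ℝ) : {z | z ∈ Icc a b ∧ f z = 0}.Finite := by
  by_contra h
  obtain ⟨t, -, ht⟩ := Set.Infinite.exists_accPt_of_subset_isCompact h isCompact_Icc
    fun z hz ↦ hz.1
  rw [accPt_iff_frequently_nhdsNE] at ht
  obtain ⟨s, hs, hs0⟩ := (ht.and_eventually (eventually_nhdsNE_ne_zero hf hf0 t)).exists
  exact hs0 hs.2

theorem zeroCount_ne_top (x : ℝ) : zeroCount f x ≠ ⊤ := by
  refine (((finite_zeros_Icc hf hf0 0 x).biUnion (t := fun z ↦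
    Prod.mk z '' Iio (analyticOrderAt f z).toNat) fun z _ ↦ (finite_Iio _).image _).subset
      fun p hp ↦ ?_).encard_lt_top.ne
  obtain ⟨hp0, hpx, hord⟩ := hp
  refine mem_iUnion₂.2 ⟨p.1, ⟨⟨hp0, hpx⟩, eq_zero_of_lt_analyticOrderAt hord⟩, p.2, ?_, rfl⟩
  rw [← ENat.natCast_toNat (analyticOrderAt_ne_top hf hf0 p.1)] at hord
  exact Nat.cast_lt.1 hord

/-- All zeros counted by `zeroCount f x` are at most the largest zero `z ≤ x`. -/
theorem exists_zero_lt_zeroCount {k : ℕ} {x : ℝ} (hx : k < zeroCount f x) :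
    ∃ z ∈ Icc 0 x, f z = 0 ∧ k < zeroCount f z := by
  have hne : {z | z ∈ Icc 0 x ∧ f z = 0}.Nonempty := by
    obtain ⟨p, hp⟩ := encard_pos.1 (zero_le.trans_lt hx)
    exact ⟨p.1, ⟨hp.1, hp.2.1⟩, eq_zero_of_lt_analyticOrderAt hp.2.2⟩
  obtain ⟨z, ⟨hzx, hz⟩, hmax⟩ := exists_max_image _ id (finite_zeros_Icc hf hf0 0 x) hne
  exact ⟨z, hzx, hz, hx.trans_le (encard_le_encard fun p hp ↦
    ⟨hp.1, hmax p.1 ⟨⟨hp.1, hp.2.1⟩, eq_zero_of_lt_analyticOrderAt hp.2.2⟩, hp.2.2⟩)⟩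

variable (hinf : {t : ℝ | 0 ≤ t ∧ f t = 0}.Infinite)
include hinf

theorem isLeast_zeroSeq (k : ℕ) : IsLeast {x | k < zeroCount f x} (zeroSeq f k) := by
  obtain ⟨x, hx⟩ := exists_lt_zeroCount hf hinf k
  obtain ⟨z₁, hz₁x, hz₁, hz₁k⟩ := exists_zero_lt_zeroCount hf hf0 hx
  obtain ⟨z, ⟨⟨hzx, -⟩, hzk⟩, hmin⟩ := exists_min_image
    ({z | z ∈ Icc 0 x ∧ f z = 0} ∩ {z | k < zeroCount f z}) id
    ((finite_zeros_Icc hf hf0 0 x).inter_of_left _) ⟨z₁, ⟨hz₁x, hz₁⟩, hz₁k⟩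
  have hleast : IsLeast {x | k < zeroCount f x} z := by
    refine ⟨hzk, fun y hy ↦ ?_⟩
    rcases le_total y x with hyx | hxy
    · obtain ⟨w, hwy, hw, hwk⟩ := exists_zero_lt_zeroCount hf hf0 hy
      exact (hmin w ⟨⟨⟨hwy.1, hwy.2.trans hyx⟩, hw⟩, hwk⟩).trans hwy.2
    · exact hzx.2.trans hxy
  have heq : zeroSeq f k = z := hleast.csInf_eq
  exact heq ▸ hleast

theorem apply_zeroSeq (k : ℕ) : f (zeroSeq f k) = 0 := by
  have hleast := isLeast_zeroSeq hf hf0 hinf k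
  obtain ⟨z, hzx, hz, hzk⟩ := exists_zero_lt_zeroCount hf hf0 hleast.1
  rwa [(hleast.2 hzk).antisymm hzx.2]

theorem monotone_zeroSeq : Monotone (zeroSeq f) := fun j k hjk ↦ by
  have hk : k < zeroCount f (zeroSeq f k) := (isLeast_zeroSeq hf hf0 hinf k).1
  exact (isLeast_zeroSeq hf hf0 hinf j).2 ((Nat.cast_le.2 hjk).trans_lt hk)

theorem tendsto_zeroSeq_atTop : Tendsto (zeroSeq f) atTop atTop := by
  refine tendsto_atTop_atTop.2 fun M ↦ ?_
  obtain ⟨m, hm⟩ := ENat.ne_top_iff_exists.1 (zeroCount_ne_top hf hf0 M)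
  refine ⟨m, fun k hk ↦ ?_⟩
  by_contra! h
  have hlt := (isLeast_zeroSeq hf hf0 hinf k).1.trans_le (zeroCount_mono f h.le)
  rw [← hm] at hlt
  exact hk.not_gt (Nat.cast_lt.1 hlt)

end AnalyticZeros

section Moments

/-- The moments `(1/T) ∫₀ᵀ |f'|^{2h} |f|^{2l-2h}` of a function and its derivative. -/
noncomputable def moment (f : ℝ → ℝ) (l h : ℕ) (T : ℝ) : ℝ :=
  1 / T * ∫ t in 0..T, |deriv f t| ^ (2 * h) * |f t| ^ (2 * l - 2 * h)

/-- The moments of `f` of order `2l` grow like `d_h (log T)^{a+2h}`, `0 ≤ h ≤ l`; for the `n`-th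
derivative of Hardy's function `a = l² + 2ln`. -/
def HasMomentAsymptotics (f : ℝ → ℝ) (l a : ℕ) (d : ℕ → ℝ) : Prop :=
  ∀ h ≤ l, moment f l h ~[atTop] fun T ↦ d h * Real.log T ^ (a + 2 * h)

/-- The polynomial `∑ₕ c_h d_h x^h`, `1 ≤ h ≤ l`. At `x = s²` it is the limit of the normalised mean
values of `energy l c (s f' / log T) f`, if `f` has the moment asymptotics `d`. -/
noncomputable def limitPoly (l : ℕ) (c d : ℕ → ℝ) : ℝ[X] :=
  ∑ h ∈ Finset.Icc 1 l, C (c h * d h) * X ^ h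

variable {f : ℝ → ℝ} {l a : ℕ} {c d : ℕ → ℝ}

theorem moment_nonneg (f : ℝ → ℝ) (l h : ℕ) {T : ℝ} (hT : 0 ≤ T) : 0 ≤ moment f l h T :=
  mul_nonneg (by positivity) (intervalIntegral.integral_nonneg hT fun t _ ↦ by positivity)

theorem moment_zero (f : ℝ → ℝ) (l : ℕ) (T : ℝ) :
    moment f l 0 T = 1 / T * ∫ t in 0..T, f t ^ (2 * l) := by
  simp only [moment, mul_zero, pow_zero, one_mul, Nat.sub_zero, (even_two_mul l).pow_abs]

theorem eval_limitPoly (l : ℕ) (c d : ℕ → ℝ) (x : ℝ) :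
    (limitPoly l c d).eval x = ∑ h ∈ Finset.Icc 1 l, c h * d h * x ^ h := by
  simp only [limitPoly, eval_finsetSum, eval_mul, eval_C, eval_pow, eval_X]

theorem eval_limitPoly_zero (l : ℕ) (c d : ℕ → ℝ) : (limitPoly l c d).eval 0 = 0 := by
  rw [eval_limitPoly]
  refine Finset.sum_eq_zero fun h hh ↦ ?_
  have := (Finset.mem_Icc.1 hh).1
  rw [zero_pow (by omega), mul_zero]

theorem degree_limitPoly_pos {h : ℕ} (hh : h ∈ Finset.Icc 1 l) (hcd : c h * d h ≠ 0) :
    0 < (limitPoly l c d).degree := by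
  have hcoeff : (limitPoly l c d).coeff h = c h * d h := by
    simp only [limitPoly, finsetSum_coeff, coeff_C_mul, coeff_X_pow, mul_ite, mul_one, mul_zero,
      Finset.sum_ite_eq, hh, if_true]
  exact (Nat.cast_pos.2 (Finset.mem_Icc.1 hh).1).trans_le
    (le_degree_of_ne_zero (hcoeff.trans_ne hcd))

theorem tendsto_div_of_isEquivalent_const_mul {lim : Filter ℝ} {g w : ℝ → ℝ} {r : ℝ}
    (h : g ~[lim] fun x ↦ r * w x) (hw : ∀ᶠ x in lim, w x ≠ 0) :
    Tendsto (fun x ↦ g x / w x) lim (𝓝 r) := by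
  have hsub := (h.isLittleO.trans_isBigO (isBigO_const_mul_self r w lim)).tendsto_div_nhds_zero
  rw [← zero_add r]
  refine (hsub.add_const r).congr' (hw.mono fun x hx ↦ ?_)
  simp only [Pi.sub_apply]
  field_simp
  ring

theorem integral_energy (hf : ContDiff ℝ 1 f) (l : ℕ) (c : ℕ → ℝ) (κ T : ℝ) :
    1 / T * ∫ t in 0..T, energy l c (κ * deriv f t) (f t) =
      ∑ h ∈ Finset.Icc 1 l, c h * (κ ^ (2 * h) * moment f l h T) := by
  have := hf.continuous_deriv le_rfl
  have hfc := hf.continuous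
  have habs (t : ℝ) : energy l c (κ * deriv f t) (f t) = ∑ h ∈ Finset.Icc 1 l,
      c h * κ ^ (2 * h) * (|deriv f t| ^ (2 * h) * |f t| ^ (2 * l - 2 * h)) := by
    refine Finset.sum_congr rfl fun h _ ↦ ?_
    rw [← Nat.mul_sub, (even_two_mul h).pow_abs, (even_two_mul (l - h)).pow_abs, mul_pow]
    ring
  simp only [habs]
  rw [intervalIntegral.integral_finsetSum fun h _ ↦ Continuous.intervalIntegrable (by fun_prop) _ _,
    Finset.mul_sum]
  refine Finset.sum_congr rfl fun h _ ↦ ?_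
  rw [intervalIntegral.integral_const_mul, moment]
  ring

namespace HasMomentAsymptotics

variable (hd : HasMomentAsymptotics f l a d)
include hd

theorem tendsto {h : ℕ} (hh : h ≤ l) :
    Tendsto (fun T ↦ moment f l h T / Real.log T ^ (a + 2 * h)) atTop (𝓝 (d h)) :=
  tendsto_div_of_isEquivalent_const_mul (hd h hh)
    ((eventually_gt_atTop 1).mono fun _ hT ↦ (pow_pos (Real.log_pos hT) _).ne')

theorem coeff_nonneg {h : ℕ} (hh : h ≤ l) : 0 ≤ d h :=
  ge_of_tendsto (hd.tendsto hh) ((eventually_gt_atTop 1).mono fun _ hT ↦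
    div_nonneg (moment_nonneg f l h (zero_le_one.trans hT.le)) (pow_pos (Real.log_pos hT) _).le)

theorem exists_deriv_ne_zero (hl : 1 ≤ l) (hdl : d l ≠ 0) : ∃ t, deriv f t ≠ 0 := by
  by_contra! h
  have hzero (T : ℝ) : moment f l l T = 0 := by simp [moment, h, show l ≠ 0 by omega]
  refine hdl (tendsto_nhds_unique (hd.tendsto le_rfl) ?_)
  simp only [hzero, zero_div, tendsto_const_nhds]

theorem exists_ne_zero (hl : 1 ≤ l) (hdl : d l ≠ 0) : ∃ t, f t ≠ 0 := by
  obtain ⟨t, ht⟩ := hd.exists_deriv_ne_zero hl hdl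
  by_contra! h
  exact ht (by rw [show f = fun _ ↦ 0 from funext h, deriv_const])

theorem coeff_pos (hf : ∀ t, AnalyticAt ℝ f t) (hl : 1 ≤ l) (hdl : d l ≠ 0) {h : ℕ} (hh : h ≤ l) :
    0 < d h := by
  refine (hd.coeff_nonneg hh).lt_of_ne fun hdh ↦ ?_
  have hequiv := hd h hh
  simp only [← hdh, zero_mul] at hequiv
  obtain ⟨T, hT, hT1⟩ := ((isEquivalent_zero_iff_eventually_zero.1 hequiv).and
    (eventually_ge_atTop 1)).exists
  have hT0 : 0 < T := one_pos.trans_le hT1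
  obtain ⟨s, hs, hs0⟩ := ((Icc_infinite hT0).sdiff
    ((finite_zeros_Icc hf (hd.exists_ne_zero hl hdl) 0 T).union
      (finite_zeros_Icc (fun t ↦ (hf t).deriv) (hd.exists_deriv_ne_zero hl hdl) 0 T))).nonempty
  have hfs : f s ≠ 0 := fun h ↦ hs0 (Or.inl ⟨hs, h⟩)
  have hfs' : deriv f s ≠ 0 := fun h ↦ hs0 (Or.inr ⟨hs, h⟩)
  have hcont : Continuous fun t ↦ |deriv f t| ^ (2 * h) * |f t| ^ (2 * l - 2 * h) :=
    continuous_iff_continuousAt.2 fun t ↦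
      ((hf t).deriv.continuousAt.abs.pow _).mul ((hf t).continuousAt.abs.pow _)
  have hpos : 0 < ∫ t in 0..T, |deriv f t| ^ (2 * h) * |f t| ^ (2 * l - 2 * h) :=
    intervalIntegral.integral_pos hT0 hcont.continuousOn (fun t _ ↦ by positivity)
      ⟨s, hs, by positivity⟩
  exact (mul_pos (by positivity) hpos).ne' hT

theorem tendsto_integral_energy (hf : ContDiff ℝ 1 f) {κ : ℝ → ℝ} {s : ℝ}
    (hκ : Tendsto (fun T ↦ κ T * Real.log T) atTop (𝓝 s)) :
    Tendsto (fun T ↦ (1 / T * ∫ t in 0..T, energy l c (κ T * deriv f t) (f t)) / Real.log T ^ a)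
      atTop (𝓝 ((limitPoly l c d).eval (s ^ 2))) := by
  have hterms : Tendsto (fun T ↦ ∑ h ∈ Finset.Icc 1 l, c h *
      (moment f l h T / Real.log T ^ (a + 2 * h)) * ((κ T * Real.log T) ^ 2) ^ h) atTop
      (𝓝 ((limitPoly l c d).eval (s ^ 2))) := by
    rw [eval_limitPoly]
    exact tendsto_finsetSum _ fun h hh ↦
      ((hd.tendsto (Finset.mem_Icc.1 hh).2).const_mul _).mul ((hκ.pow 2).pow h)
  refine hterms.congr' ((eventually_gt_atTop 1).mono fun T hT ↦ ?_)
  have := (Real.log_pos hT).ne'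
  beta_reduce
  rw [integral_energy hf, Finset.sum_div]
  refine Finset.sum_congr rfl fun h _ ↦ ?_
  rw [← pow_mul, mul_pow, pow_add]
  field_simp

theorem monotoneOn_limitPoly (hf : ContDiff ℝ 1 f) (hL : IsLagrangian (lagrangian l c)) :
    MonotoneOn (fun x ↦ (limitPoly l c d).eval x) (Ici 0) := by
  intro x hx y hy hxy
  have hlim (s : ℝ) : Tendsto (fun T ↦ s / Real.log T * Real.log T) atTop (𝓝 s) :=
    tendsto_const_nhds.congr' ((eventually_gt_atTop 1).mono fun T hT ↦
      (div_mul_cancel₀ s (Real.log_pos hT).ne').symm)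
  have hcont (κ : ℝ) : Continuous fun t ↦ energy l c (κ * deriv f t) (f t) :=
    continuous_energy ((hf.continuous_deriv le_rfl).const_mul κ) hf.continuous
  have hle : (limitPoly l c d).eval (√x ^ 2) ≤ (limitPoly l c d).eval (√y ^ 2) := by
    refine le_of_tendsto_of_tendsto (hd.tendsto_integral_energy hf (hlim √x))
      (hd.tendsto_integral_energy hf (hlim √y)) ((eventually_gt_atTop 1).mono fun T hT ↦ ?_)
    have hlog := Real.log_pos hT
    have hT0 : 0 < T := one_pos.trans hT
    beta_reduce
    gcongr
    refine intervalIntegral.integral_mono_on hT0.le ((hcont _).intervalIntegrable _ _)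
      ((hcont _).intervalIntegrable _ _) fun t _ ↦ energy_le_energy hL ?_ _
    rw [abs_mul, abs_mul, abs_of_nonneg (by positivity : 0 ≤ √x / Real.log T),
      abs_of_nonneg (by positivity : 0 ≤ √y / Real.log T)]
    gcongr
  rwa [Real.sq_sqrt hx, Real.sq_sqrt hy] at hle

end HasMomentAsymptotics

end Moments

section Gaps

theorem tendsto_div_log_atTop : Tendsto (fun T ↦ T / Real.log T) atTop atTop := by
  have hzero : Tendsto (fun T ↦ Real.log T / T) atTop (𝓝[>] 0) :=
    tendsto_nhdsWithin_iff.2 ⟨Real.isLittleO_log_id_atTop.tendsto_div_nhds_zero,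
      (eventually_gt_atTop 1).mono fun T hT ↦ div_pos (Real.log_pos hT) (one_pos.trans hT)⟩
  simpa only [Pi.inv_def, inv_div] using hzero.inv_tendsto_nhdsGT_zero

theorem tendsto_log_mul_div_log_div_log {r : ℝ} (hr : 0 < r) :
    Tendsto (fun T ↦ Real.log (r * (T / Real.log T)) / Real.log T) atTop (𝓝 1) := by
  have hloglog : Tendsto (fun T ↦ Real.log (Real.log T) / Real.log T) atTop (𝓝 0) :=
    Real.isLittleO_log_id_atTop.tendsto_div_nhds_zero.comp Real.tendsto_log_atTop
  have hconst : Tendsto (fun T ↦ Real.log r / Real.log T) atTop (𝓝 0) :=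
    tendsto_const_nhds.div_atTop Real.tendsto_log_atTop
  have hsum := (hconst.add_const 1).sub hloglog
  rw [zero_add, sub_zero] at hsum
  refine hsum.congr' ((eventually_gt_atTop 1).mono fun T hT ↦ ?_)
  have hlog := Real.log_pos hT
  beta_reduce
  rw [Real.log_mul hr.ne' (by positivity), Real.log_div (by positivity) hlog.ne']
  field_simp
  ring

variable {f : ℝ → ℝ} {l a : ℕ} {c d : ℕ → ℝ}

theorem HasMomentAsymptotics.tendsto_integral_pow (hd : HasMomentAsymptotics f l a d) :
    Tendsto (fun T ↦ (1 / T * ∫ t in 0..T, f t ^ (2 * l)) / Real.log T ^ a) atTop (𝓝 (d 0)) := by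
  simpa only [moment_zero, mul_zero, add_zero] using hd.tendsto (Nat.zero_le l)

theorem HasMomentAsymptotics.tendsto_initial_integral_pow (hd : HasMomentAsymptotics f l a d) :
    Tendsto (fun T ↦ (1 / T * ∫ t in 0..2 * (T / Real.log T), f t ^ (2 * l)) / Real.log T ^ a)
      atTop (𝓝 0) := by
  have hS : Tendsto (fun T ↦ 2 * (T / Real.log T)) atTop atTop :=
    tendsto_div_log_atTop.const_mul_atTop two_pos
  have hlim := (tendsto_const_nhds (x := (2 : ℝ)).div_atTop Real.tendsto_log_atTop).mul
    ((hd.tendsto_integral_pow.comp hS).mul ((tendsto_log_mul_div_log_div_log two_pos).pow a))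
  rw [zero_mul] at hlim
  refine hlim.congr' ?_
  filter_upwards [eventually_gt_atTop 1, hS.eventually_gt_atTop 1] with T hT hST
  have hlog := Real.log_pos hT
  have hlogS := (pow_pos (Real.log_pos hST) a).ne'
  simp only [Function.comp_apply, div_pow]
  generalize Real.log (2 * (T / Real.log T)) ^ a = L at hlogS ⊢
  generalize (∫ t in 0..2 * (T / Real.log T), f t ^ (2 * l)) = I
  field_simp

theorem mul_integral_pow_le_integral_energy_of_zeros (hL : IsLagrangian (lagrangian l c)) {K : ℝ}
    (hK : 0 < K) (hf : ContDiff ℝ 1 f) {t : ℕ → ℝ} (ht : Monotone t) (hft : ∀ k, f (t k) = 0)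
    {κ : ℝ} (hκ : 0 < κ) {m n : ℕ} (hmn : m ≤ n)
    (hgap : ∀ k, m ≤ k → l * ((t (k + 1) - t k) / κ) <
      ∫ u in Ioi 0, logKernel (hamiltonian (lagrangian l c)) K u) :
    K * ∫ s in t m..t n, f s ^ (2 * l) ≤ ∫ s in t m..t n, energy l c (κ * deriv f s) (f s) := by
  have henergy (x y : ℝ) :
      IntervalIntegrable (fun s ↦ energy l c (κ * deriv f s) (f s)) volume x y :=
    (continuous_energy ((hf.continuous_deriv le_rfl).const_mul κ)
      hf.continuous).intervalIntegrable x y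
  have hpow (x y : ℝ) : IntervalIntegrable (fun s ↦ f s ^ (2 * l)) volume x y :=
    (hf.continuous.pow _).intervalIntegrable x y
  induction n, hmn using Nat.le_induction with
  | base => simp only [intervalIntegral.integral_same, mul_zero, le_refl]
  | succ k hk ih =>
    rw [← intervalIntegral.integral_add_adjacent_intervals (hpow _ (t k)) (hpow _ _),
      ← intervalIntegral.integral_add_adjacent_intervals (henergy _ (t k)) (henergy _ _), mul_add]
    exact add_le_add ih (mul_integral_pow_le_integral_energy hL hK hf (ht k.le_succ) (hft k)
      (hft (k + 1)) hκ (hgap k hk))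

theorem exists_first_index_ge {t : ℕ → ℝ} (ht : Monotone t) {m n : ℕ} {x δ : ℝ} (hm : t m < x)
    (hn : x ≤ t n) (hgap : ∀ k, m ≤ k → t (k + 1) - t k ≤ δ) :
    ∃ k, m ≤ k ∧ k ≤ n ∧ x ≤ t k ∧ t k ≤ x + δ := by
  classical
  have hex : ∃ k, x ≤ t k := ⟨n, hn⟩
  have hlt : m < Nat.find hex := by
    by_contra! h
    exact hm.not_ge ((Nat.find_spec hex).trans (ht h))
  obtain ⟨j, hj⟩ := Nat.exists_eq_succ_of_ne_zero (Nat.ne_zero_of_lt hlt)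
  refine ⟨Nat.find hex, hlt.le, Nat.find_min' hex hn, Nat.find_spec hex, ?_⟩
  have hjx : t j < x := not_le.1 (Nat.find_min hex (by omega))
  have hjgap := hgap j (by omega)
  rw [hj]
  linarith

theorem mul_sub_integral_pow_le_integral_energy (hL : IsLagrangian (lagrangian l c)) {K : ℝ}
    (hK : 0 < K) (hf : ContDiff ℝ 1 f) {κ : ℝ} {x y z : ℝ} (hx : 0 ≤ x) (hxy : x ≤ y) (hyz : y ≤ z)
    (hmain : K * ∫ s in x..z, f s ^ (2 * l) ≤ ∫ s in x..z, energy l c (κ * deriv f s) (f s)) :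
    K * ((∫ s in 0..z, f s ^ (2 * l)) - ∫ s in 0..y, f s ^ (2 * l)) ≤
      ∫ s in 0..z, energy l c (κ * deriv f s) (f s) := by
  have henergy : Continuous fun s ↦ energy l c (κ * deriv f s) (f s) :=
    continuous_energy ((hf.continuous_deriv le_rfl).const_mul κ) hf.continuous
  have hpow (x y : ℝ) : IntervalIntegrable (fun s ↦ f s ^ (2 * l)) volume x y :=
    (hf.continuous.pow _).intervalIntegrable x y
  rw [intervalIntegral.integral_interval_sub_left (hpow _ _) (hpow _ _)]
  calc K * ∫ s in y..z, f s ^ (2 * l) ≤ K * ∫ s in x..z, f s ^ (2 * l) :=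
        mul_le_mul_of_nonneg_left (intervalIntegral.integral_mono_interval hxy hyz le_rfl
          (Eventually.of_forall fun s ↦ (even_two_mul l).pow_nonneg (f s)) (hpow _ _)) hK.le
    _ ≤ ∫ s in x..z, energy l c (κ * deriv f s) (f s) := hmain
    _ ≤ ∫ s in 0..z, energy l c (κ * deriv f s) (f s) :=
        intervalIntegral.integral_mono_interval hx (hxy.trans hyz) le_rfl
          (Eventually.of_forall fun s ↦ energy_nonneg hL _ _) (henergy.intervalIntegrable _ _)

theorem eventually_gap_le_one {t : ℕ → ℝ} (ht_top : Tendsto t atTop atTop) {B : ℝ} (hB : 0 < B)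
    (hgap : ∀ᶠ k in atTop, t (k + 1) - t k < B * (2 * Real.pi / Real.log (t k))) :
    ∀ᶠ k in atTop, t (k + 1) - t k ≤ 1 := by
  filter_upwards [hgap, (Real.tendsto_log_atTop.comp ht_top).eventually_ge_atTop
    (B * (2 * Real.pi))] with k hk (hlog : B * (2 * Real.pi) ≤ Real.log (t k))
  refine hk.le.trans ?_
  rw [← mul_div_assoc]
  exact div_le_one_of_le₀ hlog (le_trans (by positivity) hlog)

/-- Cutting at `T / log T` lets all gaps be measured by `log (T / log T) ~ log T`, and the integral
up to this point is negligible. -/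
theorem eventually_mul_sub_integral_pow_le_integral_energy
    (hL : IsLagrangian (lagrangian l c)) {K : ℝ} (hK : 0 < K)
    (hint : ∫ u in Ioi 0, logKernel (hamiltonian (lagrangian l c)) K u = l * Real.pi)
    (hf : ContDiff ℝ 1 f) {t : ℕ → ℝ} (ht : Monotone t) (ht_top : Tendsto t atTop atTop)
    (hft : ∀ k, f (t k) = 0) {B : ℝ} (hB : 0 < B)
    (hgap : ∀ᶠ k in atTop, t (k + 1) - t k < B * (2 * Real.pi / Real.log (t k))) :
    ∀ᶠ n in atTop, K * ((∫ s in 0..t n, f s ^ (2 * l)) -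
        ∫ s in 0..2 * (t n / Real.log (t n)), f s ^ (2 * l)) ≤
      ∫ s in 0..t n, energy l c (2 * B / Real.log (t n / Real.log (t n)) * deriv f s) (f s) := by
  have hl : (0 : ℝ) < l := Nat.cast_pos.2 hL.one_le
  have hlog_top := Real.tendsto_log_atTop.comp ht_top
  have hcut_top := tendsto_div_log_atTop.comp ht_top
  obtain ⟨m, hm⟩ := eventually_atTop.1 (hgap.and (eventually_gap_le_one ht_top hB hgap))
  filter_upwards [hcut_top.eventually_gt_atTop (t m), hcut_top.eventually_gt_atTop 1,
    hlog_top.eventually_ge_atTop 2, ht_top.eventually_ge_atTop 0]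
    with n (hmn : t m < t n / Real.log (t n)) (hn1 : 1 < t n / Real.log (t n))
      (hlog : 2 ≤ Real.log (t n)) hn0
  set x := t n / Real.log (t n)
  have hxn : 2 * x ≤ t n := by
    rw [← mul_div_assoc, div_le_iff₀ (by linarith), mul_comm]
    exact mul_le_mul_of_nonneg_left hlog hn0
  obtain ⟨j, hmj, hjn, hxj, hjx⟩ := exists_first_index_ge ht hmn (by linarith : x ≤ t n)
    fun k hk ↦ (hm k hk).2
  have hlogx : 0 < Real.log x := Real.log_pos hn1
  refine mul_sub_integral_pow_le_integral_energy hL hK hf (by linarith) (by linarith : t j ≤ 2 * x)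
    hxn (mul_integral_pow_le_integral_energy_of_zeros hL hK hf ht hft (by positivity) hjn
      fun k hjk ↦ ?_)
  rw [hint]
  refine mul_lt_mul_of_pos_left ?_ hl
  rw [div_lt_iff₀ (by positivity)]
  calc t (k + 1) - t k < B * (2 * Real.pi / Real.log (t k)) := (hm k (hmj.trans hjk)).1
    _ ≤ B * (2 * Real.pi / Real.log x) := by
        gcongr
        exact hxj.trans (ht hjk)
    _ = Real.pi * (2 * B / Real.log x) := by ring

theorem mul_le_eval_limitPoly_of_gaps (hL : IsLagrangian (lagrangian l c)) {K : ℝ} (hK : 0 < K)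
    (hint : ∫ u in Ioi 0, logKernel (hamiltonian (lagrangian l c)) K u = l * Real.pi)
    (hf : ContDiff ℝ 1 f) (hd : HasMomentAsymptotics f l a d) {t : ℕ → ℝ} (ht : Monotone t)
    (ht_top : Tendsto t atTop atTop) (hft : ∀ k, f (t k) = 0) {B : ℝ} (hB : 0 < B)
    (hgap : ∀ᶠ k in atTop, t (k + 1) - t k < B * (2 * Real.pi / Real.log (t k))) :
    K * d 0 ≤ (limitPoly l c d).eval ((2 * B) ^ 2) := by
  have hκ : Tendsto (fun T ↦ 2 * B / Real.log (T / Real.log T) * Real.log T) atTop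
      (𝓝 (2 * B)) := by
    have := (tendsto_log_mul_div_log_div_log one_pos).inv₀ one_ne_zero |>.const_mul (2 * B)
    simpa only [inv_one, mul_one, one_mul, inv_div, ← mul_div_assoc, div_mul_eq_mul_div] using this
  have hlower := ((hd.tendsto_integral_pow.sub hd.tendsto_initial_integral_pow).const_mul K).comp
    ht_top
  rw [sub_zero] at hlower
  refine le_of_tendsto_of_tendsto hlower ((hd.tendsto_integral_energy hf hκ).comp ht_top) ?_
  filter_upwards [eventually_mul_sub_integral_pow_le_integral_energy hL hK hint hf ht ht_top hft hB
    hgap, ht_top.eventually_gt_atTop 1] with n hn hn1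
  have hlog := Real.log_pos hn1
  have : 0 < t n := one_pos.trans hn1
  simp only [Function.comp_apply]
  rw [← sub_div, ← mul_sub, ← mul_div_assoc, mul_left_comm]
  gcongr

end Gaps

section PositiveRoot

variable {l : ℕ} {d v : ℕ → ℝ}

theorem isPosRoot_iff (hdl : d l ≠ 0) {lam X : ℝ} : IsPosRoot l d v lam X ↔
    0 < X ∧ (limitPoly l (coef l v) d).eval (4 * X) = (2 * (l : ℝ) - 1) * lam * d 0 := by
  have h4 : (4 : ℝ) ^ l * d l ≠ 0 := mul_ne_zero (by positivity) hdl
  have hratio (h : ℕ) : ratioB l d h = 4 ^ h * d h / (4 ^ l * d l) := by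
    rw [ratioB, zpow_sub₀ four_ne_zero, zpow_natCast, zpow_natCast, div_mul_div_comm]
  have hleft : ∑ h ∈ Finset.Icc 1 l,
      (2 * (l : ℝ) - 1) / (2 * (h : ℝ) - 1) * (l.choose h : ℝ) * ratioB l d h * v h * X ^ h =
        (limitPoly l (coef l v) d).eval (4 * X) / (4 ^ l * d l) := by
    rw [eval_limitPoly, Finset.sum_div]
    refine Finset.sum_congr rfl fun h _ ↦ ?_
    rw [hratio, coef]
    ring
  rw [IsPosRoot, hleft, hratio, pow_zero, one_mul, ← mul_div_assoc, div_left_inj' h4]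

theorem existsUnique_isPosRoot (hdeg : 0 < (limitPoly l (coef l v) d).degree)
    (hmono : MonotoneOn (fun x ↦ (limitPoly l (coef l v) d).eval x) (Ici 0)) (hdl : d l ≠ 0)
    {lam : ℝ} (hlam : 0 < (2 * (l : ℝ) - 1) * lam * d 0) : ∃! X, IsPosRoot l d v lam X := by
  have hroot := existsUnique_pos_eval_eq hdeg hmono ((eval_limitPoly_zero l _ d).trans_lt hlam)
  have h4 : (0 : ℝ) < 4 := four_pos
  simpa only [isPosRoot_iff hdl, Equiv.mulLeft₀_apply, mul_pos_iff_of_pos_left h4] using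
    (Equiv.mulLeft₀ (4 : ℝ) four_ne_zero).bijective.existsUnique_iff.1 hroot

end PositiveRoot

section GapLimsup

variable {f : ℝ → ℝ} {l a : ℕ} {c d : ℕ → ℝ}

open Classical in
/-- The limit superior of the gaps between consecutive non-negative zeros of `f`, normalised as in
`theta`; it is `⊤` if there are only finitely many zeros. -/
noncomputable def gapLimsup (f : ℝ → ℝ) : EReal :=
  if {t : ℝ | 0 ≤ t ∧ f t = 0}.Infinite then
    limsup (fun k ↦ (((zeroSeq f (k + 1) - zeroSeq f k) /
      (2 * Real.pi / Real.log (zeroSeq f k)) : ℝ) : EReal)) atTop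
  else ⊤

theorem theta_eq_gapLimsup (n : ℕ) : theta n = gapLimsup (hardyZDeriv n) := rfl

theorem gapLimsup_nonneg (hf : ∀ t, AnalyticAt ℝ f t) (hf0 : ∃ t, f t ≠ 0) : 0 ≤ gapLimsup f := by
  rw [gapLimsup]
  split_ifs with hinf
  · refine le_limsup_of_frequently_le (Eventually.frequently ?_)
    filter_upwards [(tendsto_zeroSeq_atTop hf hf0 hinf).eventually_gt_atTop 1] with k hk
    have hlog := Real.log_pos hk
    exact EReal.coe_nonneg.2 (div_nonneg
      (sub_nonneg.2 (monotone_zeroSeq hf hf0 hinf k.le_succ)) (by positivity))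
  · exact le_top

theorem mul_le_eval_limitPoly_of_gapLimsup_lt (hL : IsLagrangian (lagrangian l c)) {K : ℝ}
    (hK : 0 < K)
    (hint : ∫ u in Ioi 0, logKernel (hamiltonian (lagrangian l c)) K u = l * Real.pi)
    (hf : ∀ t, AnalyticAt ℝ f t) (hf0 : ∃ t, f t ≠ 0) (hd : HasMomentAsymptotics f l a d) {B : ℝ}
    (hB : 0 < B) (hgap : gapLimsup f < B) : K * d 0 ≤ (limitPoly l c d).eval ((2 * B) ^ 2) := by
  rw [gapLimsup] at hgap
  split_ifs at hgap with hinf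
  · have ht_top := tendsto_zeroSeq_atTop hf hf0 hinf
    refine mul_le_eval_limitPoly_of_gaps hL hK hint
      (contDiff_iff_contDiffAt.2 fun t ↦ (hf t).contDiffAt) hd (monotone_zeroSeq hf hf0 hinf) ht_top
      (apply_zeroSeq hf hf0 hinf) hB ?_
    filter_upwards [eventually_lt_of_limsup_lt hgap, ht_top.eventually_gt_atTop 1] with k hk hk1
    have hlog := Real.log_pos hk1
    exact (div_lt_iff₀ (by positivity)).1 (EReal.coe_lt_coe_iff.1 hk)
  · exact absurd hgap not_top_lt

theorem coe_le_sq_of_forall_lt {x : ℝ} {y : EReal} (hy : 0 ≤ y)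
    (h : ∀ b : ℝ, 0 < b → y < b → x ≤ b ^ 2) : (x : EReal) ≤ y ^ 2 := by
  induction y with
  | bot => exact absurd hy (by simp)
  | top => simp [sq]
  | coe r =>
    have hr : 0 ≤ r := EReal.coe_nonneg.1 hy
    suffices x ≤ r ^ 2 by exact_mod_cast this
    have hlim : Tendsto (fun b : ℝ ↦ b ^ 2) (𝓝[>] r) (𝓝 (r ^ 2)) :=
      ((continuous_pow 2).tendsto r).mono_left nhdsWithin_le_nhds
    exact ge_of_tendsto hlim (eventually_nhdsWithin_of_forall fun b (hb : r < b) ↦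
      h b (hr.trans_lt hb) (EReal.coe_lt_coe_iff.2 hb))

end GapLimsup

section HardyZ

theorem analyticAt_Gamma {s : ℂ} (hs : Complex.Gamma s ≠ 0) : AnalyticAt ℂ Complex.Gamma s := by
  simpa only [inv_inv] using
    (Complex.differentiable_one_div_Gamma.analyticAt s).fun_inv (inv_ne_zero hs)

theorem analyticAt_riemannZeta {s : ℂ} (hs : s ≠ 1) : AnalyticAt ℂ riemannZeta s :=
  DifferentiableOn.analyticAt (s := {1}ᶜ)
    (fun _ hz ↦ (differentiableAt_riemannZeta hz).differentiableWithinAt)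
    (isOpen_compl_singleton.mem_nhds hs)

theorem analyticAt_hardyZExpr (t : ℝ) : AnalyticAt ℝ hardyZExpr t := by
  have hG0 : Complex.Gamma (1 / 4 + Complex.I * t / 2) ≠ 0 :=
    Complex.Gamma_ne_zero_of_re_pos (by norm_num)
  have hne : (1 / 2 + Complex.I * t : ℂ) ≠ 1 := fun h ↦ by
    have := congrArg Complex.re h
    norm_num at this
  have hlin : AnalyticAt ℝ (fun t : ℝ ↦ Complex.I * (t : ℂ)) t :=
    analyticAt_const.mul (Complex.ofRealCLM.analyticAt t)
  have hpow : AnalyticAt ℝ (fun t : ℝ ↦ (Real.pi : ℂ) ^ (-(Complex.I * t / 2))) t :=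
    (analyticAt_const.cpow analyticAt_id
      (Complex.ofReal_mem_slitPlane.2 Real.pi_pos)).restrictScalars.comp hlin.div_const.neg
  have hGamma : AnalyticAt ℝ (fun t : ℝ ↦ Complex.Gamma (1 / 4 + Complex.I * t / 2)) t :=
    (analyticAt_Gamma hG0).restrictScalars.comp (f := fun t : ℝ ↦ 1 / 4 + Complex.I * t / 2)
      (analyticAt_const.add hlin.div_const)
  have hzeta : AnalyticAt ℝ (fun t : ℝ ↦ riemannZeta (1 / 2 + Complex.I * t)) t :=
    (analyticAt_riemannZeta hne).restrictScalars.comp (f := fun t : ℝ ↦ 1 / 2 + Complex.I * t)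
      (analyticAt_const.add hlin)
  have hnorm : AnalyticAt ℝ
      (fun t : ℝ ↦ (‖Complex.Gamma (1 / 4 + Complex.I * t / 2)‖ : ℂ)) t :=
    (Complex.ofRealCLM.analyticAt _).comp (hGamma.contDiffAt.norm ℝ hG0).analyticAt
  exact (hpow.mul (hGamma.div hnorm (Complex.ofReal_ne_zero.2 (norm_ne_zero_iff.2 hG0)))).mul hzeta

theorem analyticAt_hardyZDeriv (n : ℕ) (t : ℝ) : AnalyticAt ℝ (hardyZDeriv n) t := by
  have hZ : AnalyticAt ℝ hardyZ t :=
    (Complex.reCLM.analyticAt _).comp (analyticAt_hardyZExpr t)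
  rw [hardyZDeriv, iteratedDeriv_eq_iterate]
  exact hZ.iterated_deriv n

theorem hasMomentAsymptotics_hardyZDeriv_iff (l n : ℕ) (d : ℕ → ℝ) :
    HasMomentAsymptotics (hardyZDeriv n) l (l ^ 2 + 2 * l * n) d ↔
      ∀ h ≤ l, IsLeadingCoeff l h n (d h) := by
  have hmoment (h : ℕ) : jointMoment l h n = moment (hardyZDeriv n) l h := by
    funext T
    simp only [jointMoment, moment, hardyZDeriv, iteratedDeriv_succ]
  simp only [HasMomentAsymptotics, IsLeadingCoeff, hmoment]

end HardyZ

end HallGap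

open HallGap in
theorem lemma2_general {f : ℝ → ℝ} (hf : ∀ t, AnalyticAt ℝ f t) {l a : ℕ} {d v : ℕ → ℝ}
    (hd : HasMomentAsymptotics f l a d) (hdl : d l ≠ 0)
    (hG : StrictMonoOn (G l v) (Set.Ici 0)) :
    (∃! lam : ℝ, IsLambda l v lam) ∧
      ∀ lam : ℝ, IsLambda l v lam →
        (∃! X : ℝ, IsPosRoot l d v lam X) ∧
          ∀ X : ℝ, IsPosRoot l d v lam X → (X : EReal) ≤ gapLimsup f ^ 2 := by
  have hL := isLagrangian_coef hG
  have hl := hL.one_le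
  have hf0 := hd.exists_ne_zero hl hdl
  have hpos {h : ℕ} (hh : h ≤ l) : 0 < d h := hd.coeff_pos hf hl hdl hh
  have hdeg : 0 < (limitPoly l (coef l v) d).degree :=
    have ⟨_, hh, hc⟩ := hL.exists_coeff_ne_zero
    degree_limitPoly_pos hh (mul_ne_zero hc (hpos (Finset.mem_Icc.1 hh).2).ne')
  have hmono := hd.monotoneOn_limitPoly (contDiff_iff_contDiffAt.2 fun t ↦ (hf t).contDiffAt) hL
  refine ⟨existsUnique_isLambda hG, fun lam hlam ↦ ?_⟩
  obtain ⟨hK, hint⟩ := (isLambda_iff hl).1 hlam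
  refine ⟨existsUnique_isPosRoot hdeg hmono hdl (mul_pos hK (hpos l.zero_le)), fun X hX ↦
    coe_le_sq_of_forall_lt (gapLimsup_nonneg hf hf0) fun B hB hgap ↦ ?_⟩
  obtain ⟨hX0, hXeq⟩ := (isPosRoot_iff hdl).1 hX
  have hle := mul_le_eval_limitPoly_of_gapLimsup_lt hL hK hint hf hf0 hd hB hgap
  rw [← hXeq] at hle
  have hXB := ((strictMonoOn_eval_of_monotoneOn hdeg hmono).le_iff_le
    (Set.mem_Ici.2 (by positivity)) (Set.mem_Ici.2 (by positivity))).1 hle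
  linarith [mul_pow 2 B 2]

theorem lemma2 (l n : ℕ) (hl : 1 ≤ l)
    (d : ℕ → ℝ) (hd : ∀ h ≤ l, HallGap.IsLeadingCoeff l h n (d h)) (hdl : d l ≠ 0)
    (v : ℕ → ℝ) (hv : v l = 1)
    (hG : StrictMonoOn (HallGap.G l v) (Set.Ici 0)) :
    (∃! lam : ℝ, HallGap.IsLambda l v lam) ∧
      ∀ lam : ℝ, HallGap.IsLambda l v lam →
        (∃! X : ℝ, HallGap.IsPosRoot l d v lam X) ∧
          ∀ X : ℝ, HallGap.IsPosRoot l d v lam X → (X : EReal) ≤ HallGap.theta n ^ 2 := by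
  rw [HallGap.theta_eq_gapLimsup]
  exact lemma2_general (HallGap.analyticAt_hardyZDeriv n)
    ((HallGap.hasMomentAsymptotics_hardyZDeriv_iff l n d).2 hd) hdl hG
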